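/- Let $p=-i\nabla$ on $\mathbb{R}^3$, let $\gamma\in(0,2/\pi)$, and put $$A:=2+\frac{2^{3/2}}{\pi(\sqrt2-1)}.$$ Let $\sqrt{p^2+1}-1-\gamma/|x|$ denote the self-adjoint operator in $L^2(\mathbb{R}^3;\mathbb{C})$ associated with the quadratic form $\langle\psi,(\sqrt{p^2+1}-1)\psi\rangle-\langle\psi,\gamma|x|^{-1}\psi\rangle$ with form domain $H^{1/2}(\mathbb{R}^3)$. Then, for every eigenfunction $\psi$ of this operator with $\|\psi\|_{L^2}=1$ and eigenvalue $E$, the quantity $\langle\psi,\gamma|x|^{-1}\psi\rangle=\int_{\mathbb{R}^3}\frac{\gamma}{|x|}|\psi(x)|^2\,dx$ is finite and $$\Big\langle\psi,\frac{\gamma}{|x|}\psi\Big\rangle\le\left(\frac{\frac2\pi A}{\frac2\pi-\gamma}+1\right)|E|.$$ -/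

import Mathlib

open MeasureTheory FourierTransform
open scoped ComplexConjugate

namespace Chandrasekhar

noncomputable section

/-- Three-dimensional Euclidean space. -/
abbrev R3 : Type := EuclideanSpace ℝ (Fin 3)

/-- The Hilbert space `L²(ℝ³; ℂ)`. -/
abbrev L2R3 : Type := Lp (α := R3) ℂ 2 (volume : Measure R3)

/-- The symbol `√(|p|² + 1) - 1` of the kinetic energy as a function of the frequency `ξ`. The
Fourier transform of Mathlib has kernel `exp (-2 π i ⟪x, ξ⟫)`, so `p = -i∇` is multiplication by
`2 π ξ` on the Fourier side. -/
def kineticSymbol (ξ : R3) : ℝ := √((2 * Real.pi * ‖ξ‖) ^ 2 + 1) - 1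

/-- The form domain `H^{1/2}(ℝ³)`: those `ψ ∈ L²(ℝ³)` with `∫ √(|p|² + 1) |ψ̂|² < ∞`. -/
def MemFormDomain (ψ : L2R3) : Prop :=
  Integrable (fun ξ : R3 => √((2 * Real.pi * ‖ξ‖) ^ 2 + 1) * ‖(𝓕 ψ : L2R3) ξ‖ ^ 2)

/-- The kinetic energy form `⟨φ, (√(p² + 1) - 1) ψ⟩` (antilinear in `φ`). -/
def kineticForm (φ ψ : L2R3) : ℂ :=
  ∫ ξ : R3, (kineticSymbol ξ : ℂ) * (conj ((𝓕 φ : L2R3) ξ) * (𝓕 ψ : L2R3) ξ)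

/-- The Coulomb form `⟨φ, γ |x|⁻¹ ψ⟩` (antilinear in `φ`). -/
def coulombForm (γ : ℝ) (φ ψ : L2R3) : ℂ :=
  ∫ x : R3, ((γ / ‖x‖ : ℝ) : ℂ) * (conj (φ x) * ψ x)

/-- The graph of the self-adjoint operator `H = √(p² + 1) - 1 - γ/|x|` in `L²(ℝ³)` associated with
the quadratic form `⟨φ, (√(p² + 1) - 1) ψ⟩ - ⟨φ, γ |x|⁻¹ ψ⟩` on `H^{1/2}(ℝ³)`, for
`0 ≤ γ < 2/π`: a function `ψ` is in the domain of `H` with `H ψ = f` if and only if `ψ` is in the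
form domain and the form applied to `(φ, ψ)` equals `⟨φ, f⟩` for all `φ` in the form domain. -/
def OperatorGraph (γ : ℝ) (ψ f : L2R3) : Prop :=
  MemFormDomain ψ ∧
    ∀ φ : L2R3, MemFormDomain φ → kineticForm φ ψ - coulombForm γ φ ψ = inner ℂ φ f

/-- `ψ` is an eigenfunction of `√(p² + 1) - 1 - γ/|x|` with eigenvalue `E`. -/
def IsEigenfunction (γ : ℝ) (E : ℂ) (ψ : L2R3) : Prop :=
  ψ ≠ 0 ∧ OperatorGraph γ ψ (E • ψ)

/-- The constant `A = 2 + 2^{3/2} / (π (√2 - 1))`. -/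
def constA : ℝ := 2 + (2 : ℝ) ^ (3 / 2 : ℝ) / (Real.pi * (√2 - 1))

end

end Chandrasekhar

/-! Write T for the kinetic symbol, s = √(p² + 1) and κ = √2/(√2 - 1). An eigenfunction satisfies
⟨γ/|x|⟩ = ⟨T⟩ - E, so it suffices to show (1 - γπ/2)⟨T⟩ ≤ A|E|; here 1 - γπ/2 is π/2 times 2/π - γ.

The virial theorem (`WeakEigen.virial`) gives ⟨1 - 1/s⟩ = -E. Hence E ≤ 0, and anything bounded by a
multiple of 1 - 1/s costs a multiple of |E|. This weight behaves like p²/2 for small p and is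
bounded below for |p| ≥ 1, so it controls low frequencies directly but not the kinetic energy at
high frequencies.

For high frequencies the eigenvalue equation is tested with the part h of ψ in |p| ≥ 1
(`WeakEigen.kinetic_le`). Since E ≤ 0, its kinetic energy is at most ⟨h, γ/|x| h⟩ plus a cross term
with the low part. Kato's inequality and |p| ≤ T + 2(1 - 1/s) on |p| ≥ 1 absorb the first term up to
the factor γπ/2 < 1. Hardy's inequality for the low part bounds the cross term by γκ|E|. Adding the
low frequencies, where T ≤ 2(1 - 1/s), gives the constant A = 2 + (2/π)κ.

Kato's and Hardy's inequalities both come from a ground state bound for the heat semigroup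
(`lintegral_mul_div_le`): a positive w with e^{sΔ}w ≤ w - D yields ∫ |f|² D/w ≤ ⟨f, (1 - e^{-sp²})f⟩
(s here is time), by the Schur test with weight w. Powers of |x| written as ∫ tᵃ Gₜ dt make e^{sΔ}w
explicit. -/

namespace Chandrasekhar

/-! ### The heat kernel and its Gamma integrals -/

/-- The heat kernel on `ℝ³`. -/
noncomputable def heatKernel (t : ℝ) (x : R3) : ℝ :=
  (4 * Real.pi * t) ^ (-(3 / 2) : ℝ) * Real.exp (-(‖x‖ ^ 2 / (4 * t)))

lemma heatKernel_pos {t : ℝ} (ht : 0 < t) (x : R3) : 0 < heatKernel t x := by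
  unfold heatKernel
  have := Real.pi_pos
  positivity

lemma heatKernel_sub_comm (t : ℝ) (x y : R3) : heatKernel t (x - y) = heatKernel t (y - x) := by
  simp only [heatKernel, norm_sub_rev x y]

lemma measurable_heatKernel : Measurable fun p : ℝ × R3 => heatKernel p.1 p.2 := by
  unfold heatKernel
  fun_prop

lemma continuous_heatKernel (t : ℝ) : Continuous (heatKernel t) := by
  unfold heatKernel
  fun_prop

lemma integrable_exp_neg_mul_norm_sq {b : ℝ} (hb : 0 < b) :
    Integrable fun x : R3 => Real.exp (-b * ‖x‖ ^ 2) := by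
  have h := GaussianFourier.integrable_cexp_neg_mul_sq_norm_add (V := R3) (b := (b : ℂ))
    (by simpa using hb) 0 0
  refine h.norm.congr (Filter.Eventually.of_forall fun x => ?_)
  simp only [Complex.norm_exp]
  congr 1
  simp [← Complex.ofReal_pow, ← Complex.ofReal_mul]

lemma lintegral_exp_neg_mul_norm_sq {b : ℝ} (hb : 0 < b) :
    ∫⁻ x : R3, ENNReal.ofReal (Real.exp (-b * ‖x‖ ^ 2)) =
      ENNReal.ofReal ((Real.pi / b) ^ (3 / 2 : ℝ)) := by
  rw [← ofReal_integral_eq_lintegral_ofReal (integrable_exp_neg_mul_norm_sq hb)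
    (Filter.Eventually.of_forall fun x => (Real.exp_pos _).le),
    GaussianFourier.integral_rexp_neg_mul_sq_norm hb]
  simp

/-- Completing the square in y: the remaining factor is a normalised Gaussian in y, so integrating
it out leaves the semigroup law. -/
lemma heatKernel_mul_heatKernel {s t : ℝ} (hs : 0 < s) (ht : 0 < t) (x y : R3) :
    heatKernel s (x - y) * heatKernel t y =
      heatKernel (s + t) x * ((4 * Real.pi * (s * t / (s + t))) ^ (-(3 / 2) : ℝ) *
        Real.exp (-((s + t) / (4 * s * t)) * ‖y - (t / (s + t)) • x‖ ^ 2)) := by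
  have hpi := Real.pi_pos
  have h1 : (4 * Real.pi * s) ^ (-(3 / 2) : ℝ) * (4 * Real.pi * t) ^ (-(3 / 2) : ℝ) =
      (4 * Real.pi * (s + t)) ^ (-(3 / 2) : ℝ) *
        (4 * Real.pi * (s * t / (s + t))) ^ (-(3 / 2) : ℝ) := by
    rw [← Real.mul_rpow (by positivity) (by positivity),
      ← Real.mul_rpow (by positivity) (by positivity)]
    congr 1
    field_simp
  have h2 : -(‖x - y‖ ^ 2 / (4 * s)) + -(‖y‖ ^ 2 / (4 * t)) = -(‖x‖ ^ 2 / (4 * (s + t))) +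
      -((s + t) / (4 * s * t)) * ‖y - (t / (s + t)) • x‖ ^ 2 := by
    rw [@norm_sub_sq_real _ _ _ x y, @norm_sub_sq_real _ _ _ y, inner_smul_right, norm_smul,
      real_inner_comm x y, Real.norm_of_nonneg (by positivity)]
    field_simp
    ring
  unfold heatKernel
  calc _ = ((4 * Real.pi * s) ^ (-(3 / 2) : ℝ) * (4 * Real.pi * t) ^ (-(3 / 2) : ℝ)) *
        Real.exp (-(‖x - y‖ ^ 2 / (4 * s)) + -(‖y‖ ^ 2 / (4 * t))) := by
        rw [Real.exp_add]; ring
    _ = _ := by rw [h1, h2, Real.exp_add]; ring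

/-- The semigroup property of the heat kernel. -/
lemma lintegral_heatKernel_mul_heatKernel {s t : ℝ} (hs : 0 < s) (ht : 0 < t) (x : R3) :
    ∫⁻ y : R3, ENNReal.ofReal (heatKernel s (x - y)) * ENNReal.ofReal (heatKernel t y) =
      ENNReal.ofReal (heatKernel (s + t) x) := by
  have hpi := Real.pi_pos
  have hst : 0 < s + t := by positivity
  have hc : 0 ≤ (4 * Real.pi * (s * t / (s + t))) ^ (-(3 / 2) : ℝ) := by positivity
  simp_rw [← ENNReal.ofReal_mul (heatKernel_pos hs _).le, heatKernel_mul_heatKernel hs ht,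
    ENNReal.ofReal_mul (heatKernel_pos hst x).le, ENNReal.ofReal_mul hc]
  rw [lintegral_const_mul _ (by fun_prop), lintegral_const_mul _ (by fun_prop),
    lintegral_sub_right_eq_self (fun y : R3 =>
      ENNReal.ofReal (Real.exp (-((s + t) / (4 * s * t)) * ‖y‖ ^ 2))),
    lintegral_exp_neg_mul_norm_sq (by positivity), ← ENNReal.ofReal_mul hc]
  have : (4 * Real.pi * (s * t / (s + t))) = Real.pi / ((s + t) / (4 * s * t)) := by
    field_simp
  rw [this, ← Real.rpow_add (by positivity)]
  simp

/-- The heat kernel as the Fourier transform of a modulated Gaussian. -/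
lemma fourier_gaussian_eq_heatKernel {t : ℝ} (ht : 0 < t) (x y : R3) :
    𝓕 (fun ξ : R3 => Complex.exp (-((4 * Real.pi ^ 2 * t : ℝ) : ℂ) * ‖ξ‖ ^ 2 +
      2 * Real.pi * Complex.I * (inner ℝ x ξ : ℝ))) y = (heatKernel t (x - y) : ℂ) := by
  have hpi := Real.pi_pos
  have hb : 0 < 4 * Real.pi ^ 2 * t := by positivity
  rw [fourier_gaussian_innerProductSpace' (V := R3) (b := ((4 * Real.pi ^ 2 * t : ℝ) : ℂ))
    (by rw [Complex.ofReal_re]; exact hb) x y]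
  have e1 : (Real.pi / ((4 * Real.pi ^ 2 * t : ℝ) : ℂ)) ^ ((Module.finrank ℝ R3 : ℂ) / 2) =
      (((4 * Real.pi * t) ^ (-(3 / 2) : ℝ) : ℝ) : ℂ) := by
    rw [← Complex.ofReal_div, show Real.pi / (4 * Real.pi ^ 2 * t) = (4 * Real.pi * t)⁻¹ by
      field_simp, Real.rpow_neg (by positivity), ← Real.inv_rpow (by positivity),
      Complex.ofReal_cpow (by positivity)]
    simp
  have e2 : -(Real.pi : ℂ) ^ 2 * (‖x - y‖ : ℂ) ^ 2 / ((4 * Real.pi ^ 2 * t : ℝ) : ℂ)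
      = ((-(‖x - y‖ ^ 2 / (4 * t)) : ℝ) : ℂ) := by
    have : (t : ℂ) ≠ 0 := by exact_mod_cast ht.ne'
    have : (Real.pi : ℂ) ≠ 0 := by exact_mod_cast hpi.ne'
    push_cast
    field_simp
  rw [e1, e2]
  unfold heatKernel
  rw [Complex.ofReal_mul, Complex.ofReal_exp]

lemma lintegral_rpow_mul_exp_neg_mul {a r : ℝ} (ha : 0 < a) (hr : 0 < r) :
    ∫⁻ t in Set.Ioi (0 : ℝ), ENNReal.ofReal (t ^ (a - 1) * Real.exp (-(r * t))) =
      ENNReal.ofReal ((1 / r) ^ a * Real.Gamma a) := by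
  have h := Real.integral_rpow_mul_exp_neg_mul_Ioi ha hr
  have hp : 0 < (1 / r) ^ a * Real.Gamma a := by
    have := Real.Gamma_pos_of_pos ha
    positivity
  rw [← h, ofReal_integral_eq_lintegral_ofReal]
  -- The Bochner integral of a non-integrable function is 0 by convention, so a positive value
  -- forces integrability.
  · by_contra hcon
    rw [integral_undef hcon] at h
    exact hp.ne h
  · filter_upwards [ae_restrict_mem measurableSet_Ioi] with t ht
    have : (0 : ℝ) < t := ht
    positivity

/-- The substitution t ↦ 1/t turns this into the Gamma integral. -/
lemma lintegral_rpow_mul_exp_neg_div {b r : ℝ} (hb : 0 < b) (hr : 0 < r) :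
    ∫⁻ t in Set.Ioi (0 : ℝ), ENNReal.ofReal (t ^ (-b - 1) * Real.exp (-(r / t))) =
      ENNReal.ofReal ((1 / r) ^ b * Real.Gamma b) := by
  have hp : 0 < (1 / r) ^ b * Real.Gamma b := by
    have := Real.Gamma_pos_of_pos hb
    positivity
  have h := Real.integral_rpow_mul_exp_neg_mul_Ioi hb hr
  rw [← integral_comp_rpow_Ioi _ (p := -1) (by norm_num)] at h
  have h' : ∫ t in Set.Ioi (0 : ℝ), t ^ (-b - 1) * Real.exp (-(r / t)) =
      (1 / r) ^ b * Real.Gamma b := by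
    rw [← h]
    refine setIntegral_congr_fun measurableSet_Ioi fun t ht => ?_
    have ht0 : (0 : ℝ) < t := ht
    simp only [smul_eq_mul]
    rw [← Real.rpow_mul ht0.le, ← mul_assoc, abs_neg, abs_one, one_mul, ← Real.rpow_add ht0,
      Real.rpow_neg_one, div_eq_mul_inv]
    congr 2
    ring
  rw [← h', ofReal_integral_eq_lintegral_ofReal]
  · by_contra hcon
    rw [integral_undef hcon] at h'
    exact hp.ne h'
  · filter_upwards [ae_restrict_mem measurableSet_Ioi] with t ht
    have : (0 : ℝ) < t := ht
    positivity

/-- `∫₀^∞ tᵃ Gₜ(x) dt` for `a < 1 / 2`. -/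
lemma lintegral_rpow_mul_heatKernel {a : ℝ} (ha : a < 1 / 2) {x : R3} (hx : x ≠ 0) :
    ∫⁻ t in Set.Ioi (0 : ℝ), ENNReal.ofReal (t ^ a * heatKernel t x) =
      ENNReal.ofReal ((4 * Real.pi) ^ (-(3 / 2) : ℝ) *
        ((4 / ‖x‖ ^ 2) ^ (1 / 2 - a) * Real.Gamma (1 / 2 - a))) := by
  have hpi := Real.pi_pos
  have hx0 : 0 < ‖x‖ := norm_pos_iff.2 hx
  have hC : 0 ≤ (4 * Real.pi) ^ (-(3 / 2) : ℝ) := by positivity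
  have h := lintegral_rpow_mul_exp_neg_div (b := 1 / 2 - a) (r := ‖x‖ ^ 2 / 4) (by linarith)
    (by positivity)
  rw [one_div_div] at h
  rw [ENNReal.ofReal_mul hC, ← h, ← lintegral_const_mul _ (by fun_prop)]
  refine setLIntegral_congr_fun measurableSet_Ioi fun t ht => ?_
  have ht0 : (0 : ℝ) < t := ht
  rw [← ENNReal.ofReal_mul hC]
  congr 1
  unfold heatKernel
  rw [Real.mul_rpow (by positivity) ht0.le, show -(1 / 2 - a) - 1 = a + -(3 / 2) by ring,
    Real.rpow_add ht0, div_div]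
  ring

/-! ### The ground state bound for the heat semigroup -/

lemma enorm_ofReal_of_nonneg {r : ℝ} (hr : 0 ≤ r) : ‖(r : ℂ)‖ₑ = ENNReal.ofReal r := by
  rw [← ofReal_norm, Complex.norm_real, Real.norm_of_nonneg hr]

lemma integral_fourier_smul_eq_integral_smul_fourier {f g : R3 → ℂ} (hf : Integrable f)
    (hg : Integrable g) : ∫ ξ, 𝓕 f ξ • g ξ = ∫ x, f x • 𝓕 g x := by
  have h := VectorFourier.integral_fourierIntegral_smul_eq_flip (L := innerₗ R3)
    Real.continuous_fourierChar continuous_inner hf hg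
  rw [flip_innerₗ] at h
  exact h

/-- The Gaussian `exp (-s |p|²)` as a function of the frequency. -/
noncomputable def heatSymbol (s : ℝ) (ξ : R3) : ℝ :=
  Real.exp (-(s * (2 * Real.pi * ‖ξ‖) ^ 2))

lemma heatSymbol_pos (s : ℝ) (ξ : R3) : 0 < heatSymbol s ξ := Real.exp_pos _

lemma heatSymbol_le_one {s : ℝ} (hs : 0 < s) (ξ : R3) : heatSymbol s ξ ≤ 1 :=
  Real.exp_le_one_iff.2 (neg_nonpos.2 (by positivity))

lemma continuous_heatSymbol (s : ℝ) : Continuous (heatSymbol s) := by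
  unfold heatSymbol
  fun_prop

/-- By the multiplication formula with a modulated Gaussian, the left-hand function is the conjugate
of the convolution of f with the heat kernel. Positivity of the kernel then gives the bound. -/
lemma enorm_fourier_heatSymbol_mul_conj_le {s : ℝ} (hs : 0 < s) (f : SchwartzMap R3 ℂ) (x : R3) :
    ‖𝓕 (fun ξ => (heatSymbol s ξ : ℂ) * conj (𝓕 (f : R3 → ℂ) ξ)) x‖ₑ ≤
      ∫⁻ y, ‖f y‖ₑ * ENNReal.ofReal (heatKernel s (x - y)) := by
  set h : R3 → ℂ := fun ξ : R3 => Complex.exp (-((4 * Real.pi ^ 2 * s : ℝ) : ℂ) * ‖ξ‖ ^ 2 +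
      2 * Real.pi * Complex.I * (inner ℝ x ξ : ℝ)) with hh
  have hi : Integrable h := GaussianFourier.integrable_cexp_neg_mul_sq_norm_add (V := R3)
    (by rw [Complex.ofReal_re]; have := Real.pi_pos; positivity) _ _
  have h1 : 𝓕 (fun ξ => (heatSymbol s ξ : ℂ) * conj (𝓕 (f : R3 → ℂ) ξ)) x =
      conj (∫ y, f y • (heatKernel s (x - y) : ℂ)) := by
    simp_rw [← fourier_gaussian_eq_heatKernel hs x]
    rw [← integral_fourier_smul_eq_integral_smul_fourier f.integrable hi, Real.fourier_eq',
      ← integral_conj]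
    refine integral_congr_ae (Filter.Eventually.of_forall fun ξ => ?_)
    simp only [smul_eq_mul, map_mul, hh, ← Complex.exp_conj, heatSymbol, Complex.ofReal_exp]
    rw [mul_comm (conj _), ← mul_assoc, ← Complex.exp_add]
    congr 2
    simp only [map_add, map_mul, map_neg, map_pow, Complex.conj_ofReal, Complex.conj_I, map_ofNat]
    rw [real_inner_comm]
    push_cast
    ring
  rw [h1, RCLike.enorm_conj]
  refine (enorm_integral_le_lintegral_enorm _).trans (le_of_eq ?_)
  refine lintegral_congr fun y => ?_
  rw [smul_eq_mul, enorm_mul, enorm_ofReal_of_nonneg (heatKernel_pos hs _).le]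

/-- This is ⟨f, e^{sΔ}f⟩ ≤ ⟨|f|, e^{sΔ}|f|⟩: the multiplication formula moves one Fourier transform
from f onto the other factor, which becomes the heat evolution. -/
lemma lintegral_heatSymbol_mul_fourier_le {s : ℝ} (hs : 0 < s) (f : SchwartzMap R3 ℂ) :
    ∫⁻ ξ, ENNReal.ofReal (heatSymbol s ξ) * ‖𝓕 (f : R3 → ℂ) ξ‖ₑ ^ 2 ≤
      ∫⁻ x, ∫⁻ y, ‖f x‖ₑ * ‖f y‖ₑ * ENNReal.ofReal (heatKernel s (x - y)) := by
  set F : SchwartzMap R3 ℂ := 𝓕 f with hF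
  have hFf : ∀ ξ, 𝓕 (f : R3 → ℂ) ξ = F ξ := fun ξ => rfl
  have hbd : ∀ ξ, ‖(heatSymbol s ξ : ℂ)‖ ≤ 1 := fun ξ => by
    rw [Complex.norm_real, Real.norm_of_nonneg (heatSymbol_pos s ξ).le]
    exact heatSymbol_le_one hs ξ
  have hc : Continuous fun ξ => (heatSymbol s ξ : ℂ) :=
    Complex.continuous_ofReal.comp (continuous_heatSymbol s)
  have hg : Integrable fun ξ => (heatSymbol s ξ : ℂ) * conj (𝓕 (f : R3 → ℂ) ξ) := by
    refine Integrable.bdd_mul (c := 1) ?_ hc.aestronglyMeasurable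
      (Filter.Eventually.of_forall hbd)
    exact (Complex.conjLIE.integrable_comp_iff (φ := fun ξ => F ξ)).2 F.integrable
  have hFF : Integrable fun ξ => (heatSymbol s ξ) * ‖F ξ‖ ^ 2 := by
    refine Integrable.bdd_mul (c := 1) ?_ (continuous_heatSymbol s).aestronglyMeasurable
      (Filter.Eventually.of_forall fun ξ => ?_)
    · exact (memLp_two_iff_integrable_sq_norm F.continuous.aestronglyMeasurable).1 (F.memLp 2)
    · simpa using hbd ξ
  have h1 : ∫ ξ, 𝓕 (f : R3 → ℂ) ξ • ((heatSymbol s ξ : ℂ) * conj (𝓕 (f : R3 → ℂ) ξ)) =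
      ((∫ ξ, heatSymbol s ξ * ‖F ξ‖ ^ 2 : ℝ) : ℂ) := by
    rw [← integral_complex_ofReal]
    refine integral_congr_ae (Filter.Eventually.of_forall fun ξ => ?_)
    simp only [hFf, smul_eq_mul]
    rw [mul_left_comm, Complex.mul_conj, Complex.normSq_eq_norm_sq]
    push_cast
    ring
  have h2 : ∫⁻ ξ, ENNReal.ofReal (heatSymbol s ξ) * ‖𝓕 (f : R3 → ℂ) ξ‖ₑ ^ 2 =
      ‖∫ ξ, 𝓕 (f : R3 → ℂ) ξ • ((heatSymbol s ξ : ℂ) * conj (𝓕 (f : R3 → ℂ) ξ))‖ₑ := by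
    have hn : ∀ ξ, 0 ≤ heatSymbol s ξ * ‖F ξ‖ ^ 2 := fun ξ =>
      mul_nonneg (heatSymbol_pos s ξ).le (by positivity)
    rw [h1, enorm_ofReal_of_nonneg (integral_nonneg hn),
      ofReal_integral_eq_lintegral_ofReal hFF (Filter.Eventually.of_forall hn)]
    refine lintegral_congr fun ξ => ?_
    rw [ENNReal.ofReal_mul (heatSymbol_pos s ξ).le, ENNReal.ofReal_pow (norm_nonneg _),
      ofReal_norm, hFf]
  rw [h2, integral_fourier_smul_eq_integral_smul_fourier f.integrable hg]
  refine (enorm_integral_le_lintegral_enorm _).trans (lintegral_mono fun x => ?_)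
  simp_rw [smul_eq_mul, enorm_mul, mul_assoc]
  rw [lintegral_const_mul' _ _ enorm_ne_top]
  gcongr
  exact enorm_fourier_heatSymbol_mul_conj_le hs f x

/-- Weighted AM-GM, from (aq - bp)² ≥ 0. It is the pointwise step of the Schur test, with p and q
the weight at the two points. -/
lemma two_mul_mul_le_add_div_mul (a b : ENNReal) {p q : ENNReal} (hp0 : p ≠ 0) (hpt : p ≠ ⊤)
    (hq0 : q ≠ 0) (hqt : q ≠ ⊤) : 2 * (a * b) ≤ a ^ 2 * (q / p) + b ^ 2 * (p / q) := by
  rcases eq_or_ne a ⊤ with rfl | ha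
  · have : q / p ≠ 0 := by simp [hq0, hpt]
    simp [ENNReal.top_mul this]
  rcases eq_or_ne b ⊤ with rfl | hb
  · have : p / q ≠ 0 := by simp [hp0, hqt]
    simp [ENNReal.top_mul this]
  lift p to NNReal using hpt
  lift q to NNReal using hqt
  lift a to NNReal using ha
  lift b to NNReal using hb
  have hp : (0 : ℝ) < p := NNReal.coe_pos.2 (pos_iff_ne_zero.2 (by exact_mod_cast hp0))
  have hq : (0 : ℝ) < q := NNReal.coe_pos.2 (pos_iff_ne_zero.2 (by exact_mod_cast hq0))
  rw [← ENNReal.coe_div (by exact_mod_cast hp0), ← ENNReal.coe_div (by exact_mod_cast hq0)]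
  norm_cast
  rw [← NNReal.coe_le_coe]
  push_cast
  have : 0 ≤ ((a : ℝ) * q - b * p) ^ 2 / (p * q) := by positivity
  have e : ((a : ℝ) * q - b * p) ^ 2 / (p * q : ℝ) =
      a ^ 2 * (q / p) + b ^ 2 * (p / q) - 2 * (a * b) := by
    field_simp
    ring
  linarith

/-- The Schur test for a symmetric kernel with a positive weight. -/
lemma lintegral_mul_kernel_le {α : Type*} [MeasurableSpace α] {μ : Measure α} [SFinite μ]
    {K : α → α → ENNReal} (hK : Measurable (Function.uncurry K)) (hsymm : ∀ x y, K x y = K y x)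
    {g w v : α → ENNReal} (hg : Measurable g) (hw : Measurable w) (hw0 : ∀ᵐ x ∂μ, w x ≠ 0)
    (hwt : ∀ᵐ x ∂μ, w x ≠ ⊤) (hv : ∀ x, ∫⁻ y, K x y * w y ∂μ = v x) :
    ∫⁻ x, ∫⁻ y, g x * g y * K x y ∂μ ∂μ ≤ ∫⁻ x, g x ^ 2 * (v x / w x) ∂μ := by
  have hKx : ∀ x, Measurable (K x) := fun x => hK.comp measurable_prodMk_left
  have hK' : Measurable fun p : α × α => K p.1 p.2 := hK
  have hm : Measurable fun p : α × α => g p.1 ^ 2 * (w p.2 / w p.1) * K p.1 p.2 := by fun_prop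
  have hm' : Measurable fun p : α × α => g p.2 ^ 2 * (w p.1 / w p.2) * K p.1 p.2 := by fun_prop
  have hI : ∫⁻ x, ∫⁻ y, g x ^ 2 * (w y / w x) * K x y ∂μ ∂μ = ∫⁻ x, g x ^ 2 * (v x / w x) ∂μ := by
    refine lintegral_congr fun x => ?_
    rw [← hv x, ENNReal.div_eq_inv_mul, ← mul_assoc, ← lintegral_const_mul _ (by fun_prop)]
    refine lintegral_congr fun y => ?_
    rw [ENNReal.div_eq_inv_mul]
    ring
  have hJ : ∫⁻ x, ∫⁻ y, g y ^ 2 * (w x / w y) * K x y ∂μ ∂μ = ∫⁻ x, g x ^ 2 * (v x / w x) ∂μ := by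
    rw [lintegral_lintegral_swap hm'.aemeasurable, ← hI]
    refine lintegral_congr fun x => lintegral_congr fun y => ?_
    rw [hsymm]
  have key : ∀ᵐ x ∂μ, ∀ᵐ y ∂μ, 2 * (g x * g y * K x y) ≤
      g x ^ 2 * (w y / w x) * K x y + g y ^ 2 * (w x / w y) * K x y := by
    filter_upwards [hw0, hwt] with x hx0 hxt
    filter_upwards [hw0, hwt] with y hy0 hyt
    rw [← add_mul, ← mul_assoc]
    gcongr
    exact two_mul_mul_le_add_div_mul _ _ hx0 hxt hy0 hyt
  refine (ENNReal.mul_le_mul_iff_right two_ne_zero ENNReal.ofNat_ne_top).1 ?_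
  calc 2 * ∫⁻ x, ∫⁻ y, g x * g y * K x y ∂μ ∂μ
      = ∫⁻ x, ∫⁻ y, 2 * (g x * g y * K x y) ∂μ ∂μ := by
        rw [← lintegral_const_mul' _ _ ENNReal.ofNat_ne_top]
        refine lintegral_congr fun x => ?_
        rw [← lintegral_const_mul' _ _ ENNReal.ofNat_ne_top]
    _ ≤ ∫⁻ x, ∫⁻ y, (g x ^ 2 * (w y / w x) * K x y + g y ^ 2 * (w x / w y) * K x y) ∂μ ∂μ := by
        refine lintegral_mono_ae ?_
        filter_upwards [key] with x hx using lintegral_mono_ae hx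
    _ = ∫⁻ x, (∫⁻ y, g x ^ 2 * (w y / w x) * K x y ∂μ +
          ∫⁻ y, g y ^ 2 * (w x / w y) * K x y ∂μ) ∂μ := by
        refine lintegral_congr fun x => lintegral_add_left ?_ _
        fun_prop
    _ = _ := by rw [lintegral_add_left hm.lintegral_prod_right', hI, hJ, two_mul]

lemma lintegral_mul_heatKernel_le {s : ℝ} {f : R3 → ℂ} (hf : Measurable f)
    {w v : R3 → ENNReal} (hw : Measurable w) (hw0 : ∀ᵐ x, w x ≠ 0) (hwt : ∀ᵐ x, w x ≠ ⊤)
    (hv : ∀ x, ∫⁻ y, ENNReal.ofReal (heatKernel s (x - y)) * w y = v x) :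
    ∫⁻ x, ∫⁻ y, ‖f x‖ₑ * ‖f y‖ₑ * ENNReal.ofReal (heatKernel s (x - y)) ≤
      ∫⁻ x, ‖f x‖ₑ ^ 2 * (v x / w x) := by
  have hK : Measurable fun p : R3 × R3 => ENNReal.ofReal (heatKernel s (p.1 - p.2)) :=
    ((continuous_heatKernel s).measurable.comp (measurable_fst.sub measurable_snd)).ennreal_ofReal
  refine lintegral_mul_kernel_le (K := fun x y => ENNReal.ofReal (heatKernel s (x - y))) hK
    (fun x y => ?_) hf.enorm hw hw0 hwt hv
  rw [heatKernel_sub_comm]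

lemma eLpNorm_two_sq {α : Type*} [MeasurableSpace α] (μ : Measure α) (f : α → ℂ) :
    eLpNorm f 2 μ ^ 2 = ∫⁻ x, ‖f x‖ₑ ^ 2 ∂μ := by
  have h := eLpNorm_nnreal_pow_eq_lintegral (p := 2) (μ := μ) (f := f) (by norm_num)
  simpa using h

lemma eLpNorm_two_withDensity_sq {m : R3 → ENNReal} (hm : Measurable m) {f : R3 → ℂ}
    (hf : Measurable f) :
    eLpNorm f 2 (volume.withDensity m) ^ 2 = ∫⁻ x, m x * ‖f x‖ₑ ^ 2 := by
  rw [eLpNorm_two_sq, lintegral_withDensity_eq_lintegral_mul _ hm (by fun_prop)]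
  rfl

lemma measurable_coe_L2 (f : L2R3) : Measurable f := (Lp.stronglyMeasurable f).measurable

lemma lintegral_enorm_sq (f : L2R3) : ∫⁻ x, ‖f x‖ₑ ^ 2 = ENNReal.ofReal (‖f‖ ^ 2) := by
  rw [← eLpNorm_two_sq, Lp.norm_def, ENNReal.ofReal_pow ENNReal.toReal_nonneg,
    ENNReal.ofReal_toReal (Lp.eLpNorm_ne_top f)]

/-- A weighted `L²` bound for the Fourier transform with weights at most one extends from Schwartz
functions to `L²`. -/
lemma lintegral_fourier_le_of_schwartz {e m : R3 → ENNReal} (he : Measurable e) (hm : Measurable m)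
    (he1 : e ≤ᵐ[volume] 1) (hm1 : m ≤ᵐ[volume] 1)
    (h : ∀ f : SchwartzMap R3 ℂ, ∫⁻ ξ, e ξ * ‖𝓕 (f : R3 → ℂ) ξ‖ₑ ^ 2 ≤ ∫⁻ x, m x * ‖f x‖ₑ ^ 2)
    (f : L2R3) :
    ∫⁻ ξ, e ξ * ‖(𝓕 f : L2R3) ξ‖ₑ ^ 2 ≤ ∫⁻ x, m x * ‖f x‖ₑ ^ 2 := by
  have he' : volume.withDensity e ≤ (volume : Measure R3) := by
    simpa using withDensity_mono he1
  have hm' : volume.withDensity m ≤ (volume : Measure R3) := by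
    simpa using withDensity_mono hm1
  rw [← eLpNorm_two_withDensity_sq he (measurable_coe_L2 _),
    ← eLpNorm_two_withDensity_sq hm (measurable_coe_L2 _)]
  gcongr
  -- Both weights are at most one, so both weighted norms are dominated by the L² norm. Replacing f
  -- by a Schwartz function within ε/2 therefore costs ε/2 on each side, the Fourier transform being
  -- an isometry.
  refine ENNReal.le_of_forall_pos_le_add fun ε hε _ => ?_
  obtain ⟨g, hg⟩ := (SchwartzMap.denseRange_toLpCLM (E := R3) (F := ℂ) (p := 2)
    (μ := volume) ENNReal.ofNat_ne_top).exists_dist_lt f (show (0 : ℝ) < ε / 2 by positivity)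
  set G : L2R3 := SchwartzMap.toLpCLM ℝ ℂ 2 volume g with hG
  have hGg : G =ᵐ[volume] g := g.coeFn_toLp 2 volume
  have hFG : (𝓕 G : L2R3) =ᵐ[volume] 𝓕 (g : R3 → ℂ) := by
    have h1 : (𝓕 G : L2R3) = (𝓕 g).toLp 2 := SchwartzMap.toLp_fourier_eq g
    rw [h1]
    exact (𝓕 g).coeFn_toLp 2 volume
  have hsub : ∀ (u v : L2R3) (ν : Measure R3), ν ≤ volume →
      eLpNorm u 2 ν ≤ eLpNorm v 2 ν + ENNReal.ofReal (dist u v) := by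
    intro u v ν hν
    have h1 : eLpNorm (fun x => u x - v x) 2 ν ≤ ENNReal.ofReal (dist u v) := by
      refine (eLpNorm_mono_measure _ hν).trans (le_of_eq ?_)
      rw [Lp.dist_def, ENNReal.ofReal_toReal]
      · rfl
      · rw [← eLpNorm_congr_ae (Lp.coeFn_sub u v)]
        exact Lp.eLpNorm_ne_top _
    have h2 : (u : R3 → ℂ) = (v : R3 → ℂ) + fun x => u x - v x := by
      ext x
      simp
    calc eLpNorm u 2 ν = eLpNorm ((v : R3 → ℂ) + fun x => u x - v x) 2 ν := by rw [← h2]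
      _ ≤ eLpNorm v 2 ν + eLpNorm (fun x => u x - v x) 2 ν :=
          eLpNorm_add_le (measurable_coe_L2 v).aestronglyMeasurable
            ((measurable_coe_L2 u).sub (measurable_coe_L2 v)).aestronglyMeasurable (by norm_num)
      _ ≤ _ := by gcongr
  have hmain : eLpNorm (𝓕 G : L2R3) 2 (volume.withDensity e) ≤
      eLpNorm G 2 (volume.withDensity m) := by
    have h1 := h g
    have e1 : eLpNorm (𝓕 G : L2R3) 2 (volume.withDensity e) =
        eLpNorm (𝓕 (g : R3 → ℂ)) 2 (volume.withDensity e) :=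
      eLpNorm_congr_ae ((withDensity_absolutelyContinuous _ _).ae_le hFG)
    have e2 : eLpNorm G 2 (volume.withDensity m) = eLpNorm g 2 (volume.withDensity m) :=
      eLpNorm_congr_ae ((withDensity_absolutelyContinuous _ _).ae_le hGg)
    rw [e1, e2]
    rw [← eLpNorm_two_withDensity_sq he (𝓕 g).continuous.measurable,
      ← eLpNorm_two_withDensity_sq hm g.continuous.measurable] at h1
    exact (ENNReal.pow_le_pow_left_iff two_ne_zero).1 h1
  have hd : dist (𝓕 f : L2R3) (𝓕 G) = dist f G :=
    (Lp.fourierTransformₗᵢ R3 ℂ).dist_map f G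
  have hdε : ENNReal.ofReal (dist f G) ≤ ENNReal.ofReal (ε / 2) := ENNReal.ofReal_le_ofReal hg.le
  calc eLpNorm (𝓕 f : L2R3) 2 (volume.withDensity e)
      ≤ eLpNorm (𝓕 G : L2R3) 2 (volume.withDensity e) + ENNReal.ofReal (dist f G) := by
        rw [← hd]
        exact hsub _ _ _ he'
    _ ≤ eLpNorm G 2 (volume.withDensity m) + ENNReal.ofReal (dist f G) := by gcongr
    _ ≤ (eLpNorm f 2 (volume.withDensity m) + ENNReal.ofReal (dist f G)) +
        ENNReal.ofReal (dist f G) := by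
        gcongr
        rw [dist_comm]
        exact hsub _ _ _ hm'
    _ ≤ (eLpNorm f 2 (volume.withDensity m) + ENNReal.ofReal (ε / 2)) +
        ENNReal.ofReal (ε / 2) := by gcongr
    _ = _ := by
        rw [add_assoc, ← ENNReal.ofReal_add (by positivity) (by positivity), add_halves,
          ENNReal.ofReal_coe_nnreal]

/-- The ground state representation bound for the heat semigroup. -/
lemma lintegral_mul_div_le {s : ℝ} (hs : 0 < s) {w v D : R3 → ENNReal} (hw : Measurable w)
    (hvm : Measurable v) (hD : Measurable D)
    (hw0 : ∀ᵐ x, w x ≠ 0) (hwt : ∀ᵐ x, w x ≠ ⊤)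
    (hv : ∀ x, ∫⁻ y, ENNReal.ofReal (heatKernel s (x - y)) * w y = v x)
    (hvD : ∀ᵐ x, v x + D x ≤ w x) (f : L2R3) :
    ∫⁻ x, ‖f x‖ₑ ^ 2 * (D x / w x) ≤
      ∫⁻ ξ, ENNReal.ofReal (1 - heatSymbol s ξ) * ‖(𝓕 f : L2R3) ξ‖ₑ ^ 2 := by
  -- The Schur test bounds ⟨f, e^{sΔ}f⟩ by ∫ |f|² v/w. Subtracting from ‖f‖² leaves at least ∫ |f|²
  -- D/w, because v/w and D/w together do not exceed one.
  have hsum : ∀ᵐ x, v x / w x + D x / w x ≤ 1 := by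
    filter_upwards [hvD] with x hx
    rw [← ENNReal.add_div]
    exact ENNReal.div_le_of_le_mul (by simpa using hx)
  have hme : Measurable fun ξ => ENNReal.ofReal (heatSymbol s ξ) :=
    (continuous_heatSymbol s).measurable.ennreal_ofReal
  have hmf := measurable_coe_L2 f
  have hmF := measurable_coe_L2 (𝓕 f)
  have h1 : ∫⁻ ξ, ENNReal.ofReal (heatSymbol s ξ) * ‖(𝓕 f : L2R3) ξ‖ₑ ^ 2 ≤
      ∫⁻ x, (v x / w x) * ‖f x‖ₑ ^ 2 := by
    refine lintegral_fourier_le_of_schwartz hme (hvm.div hw) ?_ ?_ (fun g => ?_) f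
    · exact Filter.Eventually.of_forall fun ξ => by
        simpa using heatSymbol_le_one hs ξ
    · filter_upwards [hsum] with x hx using le_self_add.trans hx
    · refine ((lintegral_heatSymbol_mul_fourier_le hs g).trans
        (lintegral_mul_heatKernel_le g.continuous.measurable hw hw0 hwt hv)).trans (le_of_eq ?_)
      exact lintegral_congr fun x => mul_comm _ _
  have h2 : (∫⁻ x, ‖f x‖ₑ ^ 2 * (D x / w x)) + ∫⁻ x, (v x / w x) * ‖f x‖ₑ ^ 2 ≤
      ENNReal.ofReal (‖f‖ ^ 2) := by
    rw [← lintegral_enorm_sq, ← lintegral_add_left (by fun_prop)]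
    refine lintegral_mono_ae ?_
    filter_upwards [hsum] with x hx
    calc _ = ‖f x‖ₑ ^ 2 * (v x / w x + D x / w x) := by ring
      _ ≤ ‖f x‖ₑ ^ 2 * 1 := by gcongr
      _ = _ := mul_one _
  have h3 : ENNReal.ofReal (‖f‖ ^ 2) =
      (∫⁻ ξ, ENNReal.ofReal (1 - heatSymbol s ξ) * ‖(𝓕 f : L2R3) ξ‖ₑ ^ 2) +
      ∫⁻ ξ, ENNReal.ofReal (heatSymbol s ξ) * ‖(𝓕 f : L2R3) ξ‖ₑ ^ 2 := by
    rw [← Lp.norm_fourier_eq f, ← lintegral_enorm_sq, ← lintegral_add_right _ (by fun_prop)]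
    refine lintegral_congr fun ξ => ?_
    rw [← add_mul, ← ENNReal.ofReal_add (sub_nonneg.2 (heatSymbol_le_one hs ξ))
      (heatSymbol_pos s ξ).le]
    simp
  -- Finiteness is what permits cancelling this term in the extended reals.
  have hfin : ∫⁻ ξ, ENNReal.ofReal (heatSymbol s ξ) * ‖(𝓕 f : L2R3) ξ‖ₑ ^ 2 ≠ ⊤ :=
    ne_top_of_le_ne_top ENNReal.ofReal_ne_top (le_add_self.trans h3.ge)
  refine (ENNReal.add_le_add_iff_right hfin).1 ?_
  calc _ ≤ (∫⁻ x, ‖f x‖ₑ ^ 2 * (D x / w x)) + ∫⁻ x, (v x / w x) * ‖f x‖ₑ ^ 2 := by gcongr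
    _ ≤ _ := h2.trans h3.le

/-! ### Kato's inequality -/

lemma setLIntegral_Ioi_comp_add_left (g : ℝ → ENNReal) (s : ℝ) :
    ∫⁻ t in Set.Ioi 0, g (s + t) = ∫⁻ t in Set.Ioi s, g t := by
  rw [← lintegral_indicator measurableSet_Ioi, ← lintegral_indicator measurableSet_Ioi,
    ← lintegral_add_left_eq_self ((Set.Ioi s).indicator g) s]
  refine lintegral_congr fun t => ?_
  simp [Set.indicator_apply]

lemma measurable_ofReal_rpow_mul_heatKernel (a : ℝ) :
    Measurable fun p : ℝ × R3 => ENNReal.ofReal (p.1 ^ a * heatKernel p.1 p.2) :=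
  ((measurable_fst.pow_const a).mul measurable_heatKernel).ennreal_ofReal

lemma measurable_setLIntegral_rpow_mul_heatKernel (a : ℝ) (S : Set ℝ) :
    Measurable fun x => ∫⁻ t in S, ENNReal.ofReal (t ^ a * heatKernel t x) :=
  (measurable_ofReal_rpow_mul_heatKernel a).lintegral_prod_left'

/-- Convolution of the heat kernel with the Riesz potential `∫₀^∞ tᵃ Gₜ dt`. -/
lemma lintegral_heatKernel_mul_lintegral_rpow {s : ℝ} (hs : 0 < s) (a : ℝ) (x : R3) :
    ∫⁻ y, ENNReal.ofReal (heatKernel s (x - y)) *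
      ∫⁻ t in Set.Ioi 0, ENNReal.ofReal (t ^ a * heatKernel t y) =
    ∫⁻ t in Set.Ioi s, ENNReal.ofReal ((t - s) ^ a * heatKernel t x) := by
  have hm : Measurable fun p : R3 × ℝ => ENNReal.ofReal (heatKernel s (x - p.1)) *
      ENNReal.ofReal (p.2 ^ a * heatKernel p.2 p.1) :=
    ((continuous_heatKernel s).measurable.comp
      (measurable_const.sub measurable_fst)).ennreal_ofReal.mul
        ((measurable_ofReal_rpow_mul_heatKernel a).comp measurable_swap)
  simp_rw [← lintegral_const_mul' _ _ ENNReal.ofReal_ne_top]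
  rw [lintegral_lintegral_swap hm.aemeasurable, ← setLIntegral_Ioi_comp_add_left
    (fun t => ENNReal.ofReal ((t - s) ^ a * heatKernel t x)) s]
  refine setLIntegral_congr_fun measurableSet_Ioi fun t ht => ?_
  have ht0 : (0 : ℝ) < t := ht
  have hta : 0 ≤ t ^ a := by positivity
  simp only [add_sub_cancel_left]
  rw [ENNReal.ofReal_mul hta, ← lintegral_heatKernel_mul_heatKernel hs ht0 x,
    ← lintegral_const_mul' _ _ ENNReal.ofReal_ne_top]
  refine lintegral_congr fun y => ?_
  rw [ENNReal.ofReal_mul hta]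
  ring

lemma rpow_mul_heatKernel_const_pos {b : ℝ} (hb : 0 < b) {x : R3} (hx : x ≠ 0) :
    0 < (4 * Real.pi) ^ (-(3 / 2) : ℝ) * ((4 / ‖x‖ ^ 2) ^ b * Real.Gamma b) := by
  have := Real.pi_pos
  have := Real.Gamma_pos_of_pos hb
  have := norm_pos_iff.2 hx
  positivity

lemma ae_ne_zero_R3 : ∀ᵐ x : R3, x ≠ 0 := by
  simp [ae_iff]

lemma lintegral_rpow_mul_heatKernel_ne_zero {a : ℝ} (ha : a < 1 / 2) {x : R3} (hx : x ≠ 0) :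
    ∫⁻ t in Set.Ioi (0 : ℝ), ENNReal.ofReal (t ^ a * heatKernel t x) ≠ 0 := by
  rw [lintegral_rpow_mul_heatKernel ha hx]
  simpa using! rpow_mul_heatKernel_const_pos (by linarith) hx

lemma lintegral_rpow_mul_heatKernel_ne_top {a : ℝ} (ha : a < 1 / 2) {x : R3} (hx : x ≠ 0) :
    ∫⁻ t in Set.Ioi (0 : ℝ), ENNReal.ofReal (t ^ a * heatKernel t x) ≠ ⊤ := by
  rw [lintegral_rpow_mul_heatKernel ha hx]
  exact ENNReal.ofReal_ne_top

lemma setLIntegral_rpow_Ici {t : ℝ} (ht : 0 < t) :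
    ∫⁻ s in Set.Ici t, ENNReal.ofReal (s ^ (-(3 / 2) : ℝ)) =
      ENNReal.ofReal (2 * t ^ (-(1 / 2) : ℝ)) := by
  have h := integral_Ioi_rpow_of_lt (a := -(3 / 2)) (by norm_num) ht
  have hi := integrableOn_Ioi_rpow_of_lt (a := -(3 / 2)) (by norm_num) ht
  have h2 : 2 * t ^ (-(1 / 2) : ℝ) = ∫ s in Set.Ioi t, s ^ (-(3 / 2) : ℝ) := by
    rw [h, show (-(3 / 2) : ℝ) + 1 = -(1 / 2) by norm_num]
    ring
  rw [setLIntegral_congr Ioi_ae_eq_Ici.symm, h2, ofReal_integral_eq_lintegral_ofReal hi]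
  filter_upwards [ae_restrict_mem measurableSet_Ioi] with s hs
  have : 0 < s := ht.trans hs
  positivity

/-- Exchanging the order of integration in `∫₀^∞ s^{-3/2} ∫₀^s g(t) dt ds`. -/
lemma lintegral_rpow_mul_setLIntegral_Ioc {g : ℝ → ENNReal} (hg : Measurable g) :
    ∫⁻ s in Set.Ioi (0 : ℝ), ENNReal.ofReal (s ^ (-(3 / 2) : ℝ)) * ∫⁻ t in Set.Ioc 0 s, g t =
      ∫⁻ t in Set.Ioi (0 : ℝ), ENNReal.ofReal (2 * t ^ (-(1 / 2) : ℝ)) * g t := by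
  set S : Set (ℝ × ℝ) := {p | p.2 ≤ p.1} with hS
  have hSm : MeasurableSet S := measurableSet_le measurable_snd measurable_fst
  set G : ℝ × ℝ → ENNReal :=
    S.indicator fun p => ENNReal.ofReal (p.1 ^ (-(3 / 2) : ℝ)) * g p.2 with hG
  have hGm : Measurable G := by
    refine Measurable.indicator ?_ hSm
    fun_prop
  have h1 : ∀ s : ℝ, ENNReal.ofReal (s ^ (-(3 / 2) : ℝ)) * ∫⁻ t in Set.Ioc 0 s, g t =
      ∫⁻ t in Set.Ioi (0 : ℝ), G (s, t) := fun s => by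
    rw [← lintegral_const_mul _ hg, ← Set.Ioi_inter_Iic, Set.inter_comm,
      ← Measure.restrict_restrict measurableSet_Iic, ← lintegral_indicator measurableSet_Iic]
    rfl
  have h2 : ∀ t ∈ Set.Ioi (0 : ℝ), ENNReal.ofReal (2 * t ^ (-(1 / 2) : ℝ)) * g t =
      ∫⁻ s in Set.Ioi (0 : ℝ), G (s, t) := fun t ht => by
    have e : Set.Ici t ∩ Set.Ioi 0 = Set.Ici t := by
      ext s
      simp only [Set.mem_inter_iff, Set.mem_Ici, Set.mem_Ioi, and_iff_left_iff_imp]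
      exact fun h => lt_of_lt_of_le ht h
    rw [← setLIntegral_rpow_Ici ht, ← lintegral_mul_const _ (by fun_prop), ← e,
      ← Measure.restrict_restrict measurableSet_Ici, ← lintegral_indicator measurableSet_Ici]
    rfl
  simp_rw [h1]
  rw [lintegral_lintegral_swap (f := fun s t => G (s, t)) hGm.aemeasurable]
  exact (setLIntegral_congr_fun measurableSet_Ioi h2).symm

lemma setLIntegral_mul_exp_Ioc {A s : ℝ} (hA : 0 ≤ A) (hs : 0 < s) :
    ∫⁻ t in Set.Ioc 0 s, ENNReal.ofReal (A * Real.exp (-(A * t))) =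
      ENNReal.ofReal (1 - Real.exp (-(s * A))) := by
  have h : ∫ t in (0 : ℝ)..s, A * Real.exp (-(A * t)) = 1 - Real.exp (-(s * A)) := by
    rw [intervalIntegral.integral_eq_sub_of_hasDerivAt
      (f := fun t => -Real.exp (-(A * t)))]
    · simp [mul_comm, sub_eq_add_neg, add_comm]
    · intro t _
      have h : HasDerivAt (fun t => -Real.exp (-(A * t))) (-(Real.exp (-(A * t)) * -(A * 1))) t :=
        ((((hasDerivAt_id' t).const_mul A).neg).exp).neg
      simpa [mul_comm] using h
    · exact Continuous.intervalIntegrable (by fun_prop) _ _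
  rw [← h, intervalIntegral.integral_of_le hs.le, ofReal_integral_eq_lintegral_ofReal]
  · exact (Continuous.integrableOn_Icc (by fun_prop)).mono_set Set.Ioc_subset_Icc_self
  · exact Filter.Eventually.of_forall fun t => by positivity

/-- The subordination formula for the square root: writing 1 - e^{-sA} as ∫₀ˢ A e^{-At} dt and
exchanging integrals reduces it to Γ(1/2). It converts bounds on 1 - e^{-sp²} into bounds on |p|. -/
lemma lintegral_rpow_mul_one_sub_exp {A : ℝ} (hA : 0 < A) :
    ∫⁻ s in Set.Ioi (0 : ℝ), ENNReal.ofReal (s ^ (-(3 / 2) : ℝ)) *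
      ENNReal.ofReal (1 - Real.exp (-(s * A))) = ENNReal.ofReal (2 * √Real.pi * √A) := by
  have hpi := Real.pi_pos
  rw [setLIntegral_congr_fun measurableSet_Ioi fun s hs => by
      rw [← setLIntegral_mul_exp_Ioc hA.le hs],
    lintegral_rpow_mul_setLIntegral_Ioc (by fun_prop)]
  have h := lintegral_rpow_mul_exp_neg_mul (a := 1 / 2) (by norm_num) hA
  rw [Real.Gamma_one_half_eq, ← Real.sqrt_eq_rpow] at h
  have e : 2 * √Real.pi * √A = 2 * A * (√(1 / A) * √Real.pi) := by
    rw [Real.sqrt_div zero_le_one, Real.sqrt_one]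
    nth_rewrite 2 [← Real.mul_self_sqrt hA.le]
    have : 0 < √A := by positivity
    field_simp
  rw [e, ENNReal.ofReal_mul (by positivity : 0 ≤ 2 * A), ← h, ← lintegral_const_mul _ (by fun_prop)]
  refine setLIntegral_congr_fun measurableSet_Ioi fun t ht => ?_
  have ht0 : (0 : ℝ) < t := ht
  rw [← ENNReal.ofReal_mul (by positivity), ← ENNReal.ofReal_mul (by positivity)]
  congr 1
  rw [show (1 / 2 - 1 : ℝ) = -(1 / 2) by norm_num]
  ring

/-- Kato's inequality `2 / (π |x|) ≤ |p|`. -/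
theorem kato_inequality (f : L2R3) :
    ∫⁻ x, ‖f x‖ₑ ^ 2 * ENNReal.ofReal (2 / (Real.pi * ‖x‖)) ≤
      ∫⁻ ξ, ENNReal.ofReal (2 * Real.pi * ‖ξ‖) * ‖(𝓕 f : L2R3) ξ‖ₑ ^ 2 := by
  have hpi := Real.pi_pos
  have hmf := measurable_coe_L2 f
  have hmF := measurable_coe_L2 (𝓕 f)
  -- With exponent 0 this is the Newtonian potential, a multiple of 1/|x|. Its heat evolution
  -- removes precisely the times up to s, so the defect is D with no loss.
  set W : R3 → ENNReal := fun x => ∫⁻ t in Set.Ioi 0, ENNReal.ofReal (t ^ (0 : ℝ) * heatKernel t x)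
    with hW
  set D : ℝ → R3 → ENNReal := fun s x =>
    ∫⁻ t in Set.Ioc 0 s, ENNReal.ofReal (t ^ (0 : ℝ) * heatKernel t x) with hD
  have hWm : Measurable W := measurable_setLIntegral_rpow_mul_heatKernel 0 _
  have hbound : ∀ s ∈ Set.Ioi (0 : ℝ), ∫⁻ x, ‖f x‖ₑ ^ 2 * (D s x / W x) ≤
      ∫⁻ ξ, ENNReal.ofReal (1 - heatSymbol s ξ) * ‖(𝓕 f : L2R3) ξ‖ₑ ^ 2 := by
    intro s hs
    refine lintegral_mul_div_le hs (w := W)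
      (v := fun x => ∫⁻ t in Set.Ioi s, ENNReal.ofReal (t ^ (0 : ℝ) * heatKernel t x)) hWm
      (measurable_setLIntegral_rpow_mul_heatKernel 0 _)
      (measurable_setLIntegral_rpow_mul_heatKernel 0 _) ?_ ?_ (fun x => ?_) ?_ f
    · filter_upwards [ae_ne_zero_R3] with x hx
      exact lintegral_rpow_mul_heatKernel_ne_zero (by norm_num) hx
    · filter_upwards [ae_ne_zero_R3] with x hx
      exact lintegral_rpow_mul_heatKernel_ne_top (by norm_num) hx
    · rw [lintegral_heatKernel_mul_lintegral_rpow hs 0 x]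
      simp
    · refine Filter.Eventually.of_forall fun x => ?_
      have hs0 : (0 : ℝ) ≤ s := (Set.mem_Ioi.1 hs).le
      have hdis : Disjoint (Set.Ioc 0 s) (Set.Ioi s) := Set.Ioc_disjoint_Ioi le_rfl
      simp only [hW]
      rw [add_comm, ← lintegral_union measurableSet_Ioi hdis, Set.Ioc_union_Ioi_eq_Ioi hs0]
  have hDm : Measurable fun p : ℝ × R3 => D p.1 p.2 := by
    have hSm : MeasurableSet {q : (ℝ × R3) × ℝ | q.2 ∈ Set.Ioc 0 q.1.1} :=
      (measurableSet_lt measurable_const measurable_snd).inter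
        (measurableSet_le measurable_snd (measurable_fst.comp measurable_fst))
    have hm : Measurable ({q : (ℝ × R3) × ℝ | q.2 ∈ Set.Ioc 0 q.1.1}.indicator fun q =>
        ENNReal.ofReal (q.2 ^ (0 : ℝ) * heatKernel q.2 q.1.2)) :=
      ((measurable_ofReal_rpow_mul_heatKernel 0).comp
        (measurable_snd.prodMk (measurable_snd.comp measurable_fst))).indicator hSm
    have e : (fun p : ℝ × R3 => D p.1 p.2) = fun p => ∫⁻ t,
        {q : (ℝ × R3) × ℝ | q.2 ∈ Set.Ioc 0 q.1.1}.indicator (fun q =>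
          ENNReal.ofReal (q.2 ^ (0 : ℝ) * heatKernel q.2 q.1.2)) (p, t) := by
      ext p
      simp only [hD]
      rw [← lintegral_indicator measurableSet_Ioc]
      rfl
    rw [e]
    exact hm.lintegral_prod_right'
  -- Integrating the defect against s^{-3/2} produces the potential with exponent -1/2, a multiple
  -- of 1/|x|². Its ratio to W is the Coulomb weight.
  have hL : ∫⁻ s in Set.Ioi (0 : ℝ), ENNReal.ofReal (s ^ (-(3 / 2) : ℝ)) *
      ∫⁻ x, ‖f x‖ₑ ^ 2 * (D s x / W x) =
      ∫⁻ x, ‖f x‖ₑ ^ 2 * ENNReal.ofReal (4 / (√Real.pi * ‖x‖)) := by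
    simp_rw [← lintegral_const_mul' _ _ ENNReal.ofReal_ne_top]
    rw [lintegral_lintegral_swap (by
      refine Measurable.aemeasurable ?_
      exact (by fun_prop : Measurable fun s : ℝ × R3 => ENNReal.ofReal (s.1 ^ (-(3 / 2) : ℝ))).mul
        (((hmf.enorm.pow_const 2).comp measurable_snd).mul
          (hDm.div (hWm.comp measurable_snd))))]
    refine lintegral_congr_ae ?_
    filter_upwards [ae_ne_zero_R3] with x hx
    have hx0 : 0 < ‖x‖ := norm_pos_iff.2 hx
    have hDx : Measurable fun s => D s x := hDm.comp (measurable_id.prodMk measurable_const)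
    have e1 : ∫⁻ s in Set.Ioi (0 : ℝ), ENNReal.ofReal (s ^ (-(3 / 2) : ℝ)) *
        (‖f x‖ₑ ^ 2 * (D s x / W x)) = ‖f x‖ₑ ^ 2 * (W x)⁻¹ *
        ∫⁻ s in Set.Ioi (0 : ℝ), ENNReal.ofReal (s ^ (-(3 / 2) : ℝ)) * D s x := by
      rw [← lintegral_const_mul _ (by fun_prop)]
      refine lintegral_congr fun s => ?_
      rw [ENNReal.div_eq_inv_mul]
      ring
    have hmx : Measurable fun t : ℝ => ENNReal.ofReal (t ^ (0 : ℝ) * heatKernel t x) :=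
      (measurable_ofReal_rpow_mul_heatKernel 0).comp (measurable_id.prodMk measurable_const)
    have hmx' : Measurable fun t : ℝ => ENNReal.ofReal (t ^ (-(1 / 2) : ℝ) * heatKernel t x) :=
      (measurable_ofReal_rpow_mul_heatKernel _).comp (measurable_id.prodMk measurable_const)
    have e2 : ∫⁻ s in Set.Ioi (0 : ℝ), ENNReal.ofReal (s ^ (-(3 / 2) : ℝ)) * D s x =
        ENNReal.ofReal (2 * ((4 * Real.pi) ^ (-(3 / 2) : ℝ) * (4 / ‖x‖ ^ 2))) := by
      simp only [hD]
      rw [lintegral_rpow_mul_setLIntegral_Ioc hmx, ENNReal.ofReal_mul zero_le_two]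
      have h := lintegral_rpow_mul_heatKernel (a := -(1 / 2)) (by norm_num) hx
      rw [show (1 / 2 - -(1 / 2) : ℝ) = 1 by norm_num, Real.rpow_one, Real.Gamma_one, mul_one] at h
      rw [← h, ← lintegral_const_mul _ hmx']
      refine setLIntegral_congr_fun measurableSet_Ioi fun t ht => ?_
      have ht0 : (0 : ℝ) < t := ht
      simp only [Real.rpow_zero, one_mul]
      rw [ENNReal.ofReal_mul zero_le_two, ENNReal.ofReal_mul (by positivity), mul_assoc]
    have e3 : W x = ENNReal.ofReal ((4 * Real.pi) ^ (-(3 / 2) : ℝ) * (2 / ‖x‖ * √Real.pi)) := by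
      have h := lintegral_rpow_mul_heatKernel (a := 0) (by norm_num) hx
      have hsq : √(4 / ‖x‖ ^ 2) = 2 / ‖x‖ := by
        rw [Real.sqrt_div' _ (by positivity), Real.sqrt_sq hx0.le,
          show (4 : ℝ) = 2 ^ 2 by norm_num, Real.sqrt_sq zero_le_two]
      rw [sub_zero, Real.Gamma_one_half_eq, ← Real.sqrt_eq_rpow, hsq] at h
      exact h
    have hc : 0 < (4 * Real.pi) ^ (-(3 / 2) : ℝ) := by positivity
    have hsp : 0 < √Real.pi := by positivity
    rw [e1, e2, e3, mul_assoc, ← ENNReal.div_eq_inv_mul, ← ENNReal.ofReal_div_of_pos (by positivity)]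
    congr 2
    field_simp
  have hR : ∫⁻ s in Set.Ioi (0 : ℝ), ENNReal.ofReal (s ^ (-(3 / 2) : ℝ)) *
      ∫⁻ ξ, ENNReal.ofReal (1 - heatSymbol s ξ) * ‖(𝓕 f : L2R3) ξ‖ₑ ^ 2 =
      ∫⁻ ξ, ENNReal.ofReal (2 * √Real.pi * (2 * Real.pi * ‖ξ‖)) * ‖(𝓕 f : L2R3) ξ‖ₑ ^ 2 := by
    simp_rw [← lintegral_const_mul' _ _ ENNReal.ofReal_ne_top]
    have hmh : Measurable fun p : ℝ × R3 => heatSymbol p.1 p.2 := by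
      unfold heatSymbol
      fun_prop
    rw [lintegral_lintegral_swap (by fun_prop)]
    refine lintegral_congr_ae ?_
    filter_upwards [ae_ne_zero_R3] with ξ hξ
    have hξ0 : 0 < ‖ξ‖ := norm_pos_iff.2 hξ
    have h := lintegral_rpow_mul_one_sub_exp (A := (2 * Real.pi * ‖ξ‖) ^ 2) (by positivity)
    rw [Real.sqrt_sq (by positivity)] at h
    rw [← h, ← lintegral_mul_const _ (by fun_prop)]
    refine lintegral_congr fun s => ?_
    rw [mul_assoc, heatSymbol]
  have hLR : ∫⁻ x, ‖f x‖ₑ ^ 2 * ENNReal.ofReal (4 / (√Real.pi * ‖x‖)) ≤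
      ∫⁻ ξ, ENNReal.ofReal (2 * √Real.pi * (2 * Real.pi * ‖ξ‖)) * ‖(𝓕 f : L2R3) ξ‖ₑ ^ 2 := by
    rw [← hL, ← hR]
    refine setLIntegral_mono' measurableSet_Ioi fun s hs => ?_
    exact mul_le_mul' le_rfl (hbound s hs)
  have hsp : 0 < √Real.pi := by positivity
  have hc : 0 < 2 * √Real.pi := by positivity
  -- The factor 2√π from the subordination formula is split off so that it cancels on both sides.
  have e : ∀ x : R3, ENNReal.ofReal (4 / (√Real.pi * ‖x‖)) =
      ENNReal.ofReal (2 * √Real.pi) * ENNReal.ofReal (2 / (Real.pi * ‖x‖)) := fun x => by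
    rw [← ENNReal.ofReal_mul hc.le]
    congr 1
    nth_rewrite 3 [← Real.mul_self_sqrt hpi.le]
    rcases eq_or_ne ‖x‖ 0 with h0 | h0
    · simp [h0]
    · field_simp
      ring
  simp_rw [e, ENNReal.ofReal_mul hc.le, mul_assoc, mul_left_comm (_ ^ 2)] at hLR
  rw [lintegral_const_mul' _ _ ENNReal.ofReal_ne_top,
    lintegral_const_mul' _ _ ENNReal.ofReal_ne_top] at hLR
  simp_rw [mul_assoc]
  exact (ENNReal.mul_le_mul_iff_right (by simpa using hpi) ENNReal.ofReal_ne_top).1 hLR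

/-! ### Hardy's inequality -/

/-- Concavity of t ↦ t^{1/4}: the graph lies below its tangent at t. The gap bounds from below the
decrease of the Hardy weight under the heat flow. -/
lemma sub_rpow_add_le {s t : ℝ} (hs : 0 < s) (ht : s < t) :
    (t - s) ^ (1 / 4 : ℝ) + s / 4 * t ^ (-(3 / 4) : ℝ) ≤ t ^ (1 / 4 : ℝ) := by
  have ht0 : 0 < t := hs.trans ht
  have hst : s / t < 1 := (div_lt_one ht0).2 ht
  have h := rpow_one_add_le_one_add_mul_self (s := -(s / t)) (p := 1 / 4) (by linarith)
    (by norm_num) (by norm_num)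
  have e1 : t - s = t * (1 + -(s / t)) := by
    field_simp
    ring
  have e2 : t ^ (-(3 / 4) : ℝ) = t ^ (1 / 4 : ℝ) / t := by
    rw [show (-(3 / 4) : ℝ) = 1 / 4 - 1 by norm_num, Real.rpow_sub_one ht0.ne']
  rw [e1, Real.mul_rpow ht0.le (by linarith), e2]
  have hp : 0 ≤ t ^ (1 / 4 : ℝ) := by positivity
  calc _ ≤ t ^ (1 / 4 : ℝ) * (1 + 1 / 4 * -(s / t)) + s / 4 * (t ^ (1 / 4 : ℝ) / t) := by gcongr
    _ = _ := by ring

/-- Hardy's inequality `1 / (4 |x|²) ≤ |p|²`. -/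
theorem hardy_inequality (f : L2R3) :
    ∫⁻ x, ‖f x‖ₑ ^ 2 * ENNReal.ofReal (1 / ‖x‖ ^ 2) ≤
      4 * ∫⁻ ξ, ENNReal.ofReal ((2 * Real.pi * ‖ξ‖) ^ 2) * ‖(𝓕 f : L2R3) ξ‖ₑ ^ 2 := by
  have hpi := Real.pi_pos
  have hmf := measurable_coe_L2 f
  have hmF := measurable_coe_L2 (𝓕 f)
  -- The exponent 1/4 makes W a multiple of |x|^{-1/2}, the zero-energy solution at the critical
  -- Hardy constant.
  set W : R3 → ENNReal := fun x =>
    ∫⁻ t in Set.Ioi 0, ENNReal.ofReal (t ^ (1 / 4 : ℝ) * heatKernel t x) with hW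
  set V : ℝ → R3 → ENNReal := fun s x =>
    ∫⁻ t in Set.Ioi s, ENNReal.ofReal (t ^ (-(3 / 4) : ℝ) * heatKernel t x) with hV
  have hWm : Measurable W := measurable_setLIntegral_rpow_mul_heatKernel _ _
  have hVm : ∀ s, Measurable (V s) := fun s => measurable_setLIntegral_rpow_mul_heatKernel _ _
  have hbound : ∀ s : ℝ, 0 < s → ∫⁻ x, ‖f x‖ₑ ^ 2 * (V s x / W x) ≤
      4 * ∫⁻ ξ, ENNReal.ofReal ((2 * Real.pi * ‖ξ‖) ^ 2) * ‖(𝓕 f : L2R3) ξ‖ₑ ^ 2 := by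
    intro s hs
    have hm1 : ∀ x : R3, Measurable fun t : ℝ =>
        ENNReal.ofReal ((t - s) ^ (1 / 4 : ℝ) * heatKernel t x) := fun x =>
      (((measurable_id.sub_const s).pow_const _).mul
        (measurable_heatKernel.comp (measurable_id.prodMk measurable_const))).ennreal_ofReal
    have h := lintegral_mul_div_le hs (w := W) (D := fun x => ENNReal.ofReal (s / 4) * V s x)
      (v := fun x => ∫⁻ t in Set.Ioi s, ENNReal.ofReal ((t - s) ^ (1 / 4 : ℝ) * heatKernel t x))
      hWm ?_ ((hVm s).const_mul _) ?_ ?_ (fun x => ?_) ?_ f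
    -- By 1 - e^{-u} ≤ u the right side is at most s p². The factor s/4 then cancels, leaving a
    -- bound independent of s.
    · have h2 : ∫⁻ ξ, ENNReal.ofReal (1 - heatSymbol s ξ) * ‖(𝓕 f : L2R3) ξ‖ₑ ^ 2 ≤
          ENNReal.ofReal (s / 4) *
          (4 * ∫⁻ ξ, ENNReal.ofReal ((2 * Real.pi * ‖ξ‖) ^ 2) * ‖(𝓕 f : L2R3) ξ‖ₑ ^ 2) := by
        rw [← mul_assoc, ← lintegral_const_mul _ (by fun_prop)]
        refine lintegral_mono fun ξ => ?_
        rw [← mul_assoc]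
        gcongr
        rw [← ENNReal.ofReal_ofNat 4, ← ENNReal.ofReal_mul (by positivity),
          ← ENNReal.ofReal_mul (by positivity)]
        refine ENNReal.ofReal_le_ofReal ?_
        have := Real.add_one_le_exp (-(s * (2 * Real.pi * ‖ξ‖) ^ 2))
        rw [heatSymbol, div_mul_cancel₀ _ (by norm_num)]
        linarith
      have h3 : ∫⁻ x, ‖f x‖ₑ ^ 2 * (ENNReal.ofReal (s / 4) * V s x / W x) =
          ENNReal.ofReal (s / 4) * ∫⁻ x, ‖f x‖ₑ ^ 2 * (V s x / W x) := by
        rw [← lintegral_const_mul' _ _ ENNReal.ofReal_ne_top]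
        refine lintegral_congr fun x => ?_
        rw [mul_div_assoc]
        ring
      rw [h3] at h
      exact (ENNReal.mul_le_mul_iff_right (by simpa using hs) ENNReal.ofReal_ne_top).1 (h.trans h2)
    · have hm : Measurable fun p : ℝ × R3 =>
          ENNReal.ofReal ((p.1 - s) ^ (1 / 4 : ℝ) * heatKernel p.1 p.2) :=
        (((measurable_fst.sub_const s).pow_const _).mul measurable_heatKernel).ennreal_ofReal
      exact hm.lintegral_prod_left'
    · filter_upwards [ae_ne_zero_R3] with x hx
      exact lintegral_rpow_mul_heatKernel_ne_zero (by norm_num) hx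
    · filter_upwards [ae_ne_zero_R3] with x hx
      exact lintegral_rpow_mul_heatKernel_ne_top (by norm_num) hx
    · exact lintegral_heatKernel_mul_lintegral_rpow hs _ x
    · refine Filter.Eventually.of_forall fun x => ?_
      simp only [hV]
      rw [← lintegral_const_mul' _ _ ENNReal.ofReal_ne_top, ← lintegral_add_left (hm1 x)]
      refine le_trans (setLIntegral_mono' measurableSet_Ioi fun t ht => ?_)
        (lintegral_mono_set (Set.Ioi_subset_Ioi hs.le))
      have hst : s < t := ht
      have ht0 : 0 < t := hs.trans hst
      have hts : 0 ≤ t - s := by linarith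
      have hk := heatKernel_pos ht0 x
      rw [← ENNReal.ofReal_mul (by positivity), ← ENNReal.ofReal_add (by positivity) (by positivity)]
      refine ENNReal.ofReal_le_ofReal ?_
      calc _ = ((t - s) ^ (1 / 4 : ℝ) + s / 4 * t ^ (-(3 / 4) : ℝ)) * heatKernel t x := by ring
        _ ≤ _ := by
          gcongr
          exact sub_rpow_add_le hs hst
  -- Times decreasing to 0: V increases to its value at 0, so monotone convergence applies. The
  -- limit ratio V/W is 1/|x|², by Γ(5/4) = Γ(1/4)/4.
  set r : ℕ → ℝ := fun n => 1 / ((n : ℝ) + 1) with hr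
  have hr0 : ∀ n, 0 < r n := fun n => by positivity
  have hrm : Antitone r := fun m n hmn => one_div_le_one_div_of_le (by positivity) (by gcongr)
  have hVmono : Monotone fun n => V (r n) := fun m n hmn x =>
    lintegral_mono_set (Set.Ioi_subset_Ioi (hrm hmn))
  have hVsup : ∀ x, ⨆ n, V (r n) x = V 0 x := fun x => by
    have hU : ⋃ n, Set.Ioi (r n) = Set.Ioi 0 := by
      ext t
      simp only [Set.mem_iUnion, Set.mem_Ioi]
      exact ⟨fun ⟨n, hn⟩ => (hr0 n).trans hn, fun ht => exists_nat_one_div_lt ht⟩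
    simp only [hV]
    rw [← hU, setLIntegral_iUnion_of_directed]
    exact directed_of_isDirected_le fun m n hmn => Set.Ioi_subset_Ioi (hrm hmn)
  calc ∫⁻ x, ‖f x‖ₑ ^ 2 * ENNReal.ofReal (1 / ‖x‖ ^ 2)
      = ∫⁻ x, ‖f x‖ₑ ^ 2 * (V 0 x / W x) := by
        refine lintegral_congr_ae ?_
        filter_upwards [ae_ne_zero_R3] with x hx
        have hx0 : 0 < ‖x‖ := norm_pos_iff.2 hx
        have hG := Real.Gamma_pos_of_pos (show (0 : ℝ) < 1 / 4 by norm_num)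
        have hq : 0 < (4 / ‖x‖ ^ 2) ^ (1 / 4 : ℝ) := by positivity
        have hc : 0 < (4 * Real.pi) ^ (-(3 / 2) : ℝ) := by positivity
        simp only [hV, hW]
        rw [lintegral_rpow_mul_heatKernel (by norm_num) hx,
          lintegral_rpow_mul_heatKernel (by norm_num) hx,
          show (1 / 2 - -(3 / 4) : ℝ) = 1 / 4 + 1 by norm_num,
          show (1 / 2 - 1 / 4 : ℝ) = 1 / 4 by norm_num, Real.Gamma_add_one (by norm_num),
          Real.rpow_add_one (by positivity), ← ENNReal.ofReal_div_of_pos (by positivity)]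
        congr 2
        field_simp
    _ = ∫⁻ x, ⨆ n, ‖f x‖ₑ ^ 2 * (V (r n) x / W x) := by
        refine lintegral_congr fun x => ?_
        rw [← hVsup, ENNReal.iSup_div, ENNReal.mul_iSup]
    _ = ⨆ n, ∫⁻ x, ‖f x‖ₑ ^ 2 * (V (r n) x / W x) := by
        refine lintegral_iSup (fun n => ?_) fun m n hmn x => ?_
        · exact (hmf.enorm.pow_const 2).mul ((hVm _).div hWm)
        · have := hVmono hmn x
          dsimp only
          gcongr
    _ ≤ _ := iSup_le fun n => hbound _ (hr0 n)

/-! ### Dilations on L² -/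

open Filter Topology

lemma integrable_norm_sq (f : L2R3) : Integrable fun x => ‖f x‖ ^ 2 :=
  (memLp_two_iff_integrable_sq_norm (Lp.memLp f).1).1 (Lp.memLp f)

lemma integral_norm_sq (f : L2R3) : ∫ x, ‖f x‖ ^ 2 = ‖f‖ ^ 2 := by
  rw [integral_eq_lintegral_of_nonneg_ae (Eventually.of_forall fun x => by positivity)
    (integrable_norm_sq f).1]
  simp_rw [ENNReal.ofReal_pow (norm_nonneg _), ofReal_norm]
  rw [lintegral_enorm_sq, ENNReal.toReal_ofReal (by positivity)]

lemma lintegral_comp_smul {g : R3 → ENNReal} (hg : Measurable g) {r : ℝ} (hr : 0 < r) :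
    ∫⁻ x, g (r • x) = ENNReal.ofReal ((r ^ 3)⁻¹) * ∫⁻ x, g x := by
  rw [← lintegral_map (f := g) (g := fun x : R3 => r • x) hg (measurable_const_smul r),
    Measure.map_addHaar_smul _ hr.ne', lintegral_smul_measure, finrank_euclideanSpace_fin,
    abs_of_pos (by positivity), smul_eq_mul]

lemma integral_comp_smul_R3 (g : R3 → ℂ) {r : ℝ} (hr : 0 < r) :
    ∫ x, g (r • x) = ((r ^ 3)⁻¹ : ℝ) * ∫ x, g x := by
  rw [Measure.integral_comp_smul, finrank_euclideanSpace_fin, abs_of_pos (by positivity),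
    Complex.real_smul]

lemma memLp_comp_smul (f : L2R3) {r : ℝ} (hr : 0 < r) : MemLp (fun x : R3 => f (r • x)) 2 := by
  have h : MemLp f 2 (Measure.map (fun x : R3 => r • x) volume) := by
    rw [Measure.map_addHaar_smul _ hr.ne']
    exact (Lp.memLp f).smul_measure ENNReal.ofReal_ne_top
  exact h.comp_of_map (measurable_const_smul r).aemeasurable

/-- The dilation `f ↦ f(r ·)` on `L²(ℝ³)`. -/
noncomputable def dilation {r : ℝ} (hr : 0 < r) (f : L2R3) : L2R3 := (memLp_comp_smul f hr).toLp

lemma coeFn_dilation {r : ℝ} (hr : 0 < r) (f : L2R3) :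
    dilation hr f =ᵐ[volume] fun x => f (r • x) := (memLp_comp_smul f hr).coeFn_toLp

lemma ae_comp_smul {p : R3 → Prop} (h : ∀ᵐ x, p x) {r : ℝ} (hr : 0 < r) :
    ∀ᵐ x : R3, p (r • x) :=
  (Measure.quasiMeasurePreserving_smul volume hr.ne').ae h

lemma dilation_sub {r : ℝ} (hr : 0 < r) (f g : L2R3) :
    dilation hr (f - g) = dilation hr f - dilation hr g := by
  refine Lp.ext ?_
  filter_upwards [coeFn_dilation hr (f - g), coeFn_dilation hr f, coeFn_dilation hr g,
    Lp.coeFn_sub (dilation hr f) (dilation hr g), ae_comp_smul (Lp.coeFn_sub f g) hr]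
    with x h1 h2 h3 h4 h5
  rw [h1, h4, h5, Pi.sub_apply, Pi.sub_apply, h2, h3]

lemma norm_dilation_sq {r : ℝ} (hr : 0 < r) (f : L2R3) :
    ‖dilation hr f‖ ^ 2 = (r ^ 3)⁻¹ * ‖f‖ ^ 2 := by
  have h : ENNReal.ofReal (‖dilation hr f‖ ^ 2) = ENNReal.ofReal ((r ^ 3)⁻¹ * ‖f‖ ^ 2) := by
    rw [← lintegral_enorm_sq, ENNReal.ofReal_mul (by positivity), ← lintegral_enorm_sq,
      ← lintegral_comp_smul ((measurable_coe_L2 f).enorm.pow_const 2) hr]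
    refine lintegral_congr_ae ?_
    filter_upwards [coeFn_dilation hr f] with x hx
    rw [hx]
  exact (ENNReal.ofReal_eq_ofReal_iff (by positivity) (by positivity)).1 h

lemma continuous_dilation {r : ℝ} (hr : 0 < r) : Continuous (dilation hr) := by
  refine LipschitzWith.continuous (K := Real.toNNReal √((r ^ 3)⁻¹))
    (LipschitzWith.of_dist_le_mul fun f g => ?_)
  rw [dist_eq_norm, dist_eq_norm, ← dilation_sub, Real.coe_toNNReal _ (by positivity)]
  refine (sq_le_sq₀ (by positivity) (by positivity)).1 (le_of_eq ?_)
  rw [norm_dilation_sq, mul_pow, Real.sq_sqrt (by positivity)]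

/-- The Fourier transform of a dilation. -/
lemma fourier_dilation {r : ℝ} (hr : 0 < r) (f : L2R3) :
    (𝓕 (dilation hr f) : L2R3) = (((r ^ 3)⁻¹ : ℝ) : ℂ) • dilation (inv_pos.2 hr) (𝓕 f) := by
  have hFc : Continuous fun f : L2R3 => (𝓕 f : L2R3) := (Lp.fourierTransformₗᵢ R3 ℂ).continuous
  refine DenseRange.induction_on
    (p := fun f => (𝓕 (dilation hr f) : L2R3) =
      (((r ^ 3)⁻¹ : ℝ) : ℂ) • dilation (inv_pos.2 hr) (𝓕 f))
    (SchwartzMap.denseRange_toLpCLM (E := R3) (F := ℂ) (p := 2) (μ := volume)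
      ENNReal.ofNat_ne_top) f (isClosed_eq (hFc.comp (continuous_dilation hr))
      ((continuous_const_smul (((r ^ 3)⁻¹ : ℝ) : ℂ)).comp
      ((continuous_dilation (inv_pos.2 hr)).comp hFc))) fun g => ?_
  set e : R3 ≃L[ℝ] R3 := ContinuousLinearEquiv.smulLeft (Units.mk0 r hr.ne') with he
  set gr : SchwartzMap R3 ℂ := SchwartzMap.compCLMOfContinuousLinearEquiv ℂ e g with hgr
  have hgr' : ∀ x, gr x = g (r • x) := fun x => rfl
  have h1 : dilation hr (SchwartzMap.toLpCLM ℝ ℂ 2 volume g) = gr.toLp 2 := by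
    refine Lp.ext ?_
    filter_upwards [coeFn_dilation hr (SchwartzMap.toLpCLM ℝ ℂ 2 volume g),
      gr.coeFn_toLp 2 volume, ae_comp_smul (g.coeFn_toLp 2 volume) hr] with x h1 h2 h3
    rw [h1, h2, hgr']
    exact h3
  have h2 : (𝓕 (SchwartzMap.toLpCLM ℝ ℂ 2 volume g) : L2R3) = (𝓕 g).toLp 2 :=
    SchwartzMap.toLp_fourier_eq g
  rw [h1, h2, SchwartzMap.toLp_fourier_eq]
  refine Lp.ext ?_
  filter_upwards [(𝓕 gr).coeFn_toLp 2 volume,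
    Lp.coeFn_smul (((r ^ 3)⁻¹ : ℝ) : ℂ) (dilation (inv_pos.2 hr) ((𝓕 g).toLp 2)),
    coeFn_dilation (inv_pos.2 hr) ((𝓕 g).toLp 2),
    ae_comp_smul ((𝓕 g).coeFn_toLp 2 volume) (inv_pos.2 hr)] with ξ e1 e2 e3 e4
  rw [e1, e2, Pi.smul_apply, e3, e4, SchwartzMap.fourier_coe, SchwartzMap.fourier_coe,
    Real.fourier_eq', Real.fourier_eq', smul_eq_mul, ← integral_comp_smul_R3 _ hr]
  refine integral_congr_ae (Eventually.of_forall fun x => ?_)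
  simp only [hgr']
  rw [inner_smul_left, inner_smul_right]
  simp [hr.ne']

lemma coeFn_fourier_dilation {r : ℝ} (hr : 0 < r) (f : L2R3) :
    (𝓕 (dilation hr f) : L2R3) =ᵐ[volume]
      fun ξ => (((r ^ 3)⁻¹ : ℝ) : ℂ) * (𝓕 f : L2R3) (r⁻¹ • ξ) := by
  rw [fourier_dilation]
  filter_upwards [Lp.coeFn_smul (((r ^ 3)⁻¹ : ℝ) : ℂ) (dilation (inv_pos.2 hr) (𝓕 f)),
    coeFn_dilation (inv_pos.2 hr) (𝓕 f)] with ξ h1 h2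
  rw [h1, Pi.smul_apply, h2, smul_eq_mul]

lemma norm_dilation_le {r : ℝ} (hr : 0 < r) (hr' : 1 / 2 ≤ r) (f : L2R3) :
    ‖dilation hr f‖ ≤ 3 * ‖f‖ := by
  refine (sq_le_sq₀ (by positivity) (by positivity)).1 ?_
  rw [norm_dilation_sq, mul_pow]
  gcongr
  have : (1 / 2 : ℝ) ^ 3 ≤ r ^ 3 := by gcongr
  calc (r ^ 3)⁻¹ ≤ ((1 / 2 : ℝ) ^ 3)⁻¹ := by gcongr
    _ ≤ 3 ^ 2 := by norm_num

/-- Strong continuity of dilations at the identity. -/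
lemma tendsto_dilation {r : ℕ → ℝ} (hr : ∀ n, 0 < r n) (hr' : ∀ n, 1 / 2 ≤ r n)
    (hlim : Tendsto r atTop (𝓝 1)) (f : L2R3) :
    Tendsto (fun n => ‖dilation (hr n) f - f‖) atTop (𝓝 0) := by
  refine Metric.tendsto_atTop.2 fun ε hε => ?_
  obtain ⟨g, hgs, hgf, hgc, hgm⟩ := (Lp.memLp f).exists_hasCompactSupport_eLpNorm_sub_le
    ENNReal.ofNat_ne_top (ε := ENNReal.ofReal (ε / 8)) (by simpa using hε)
  set G : L2R3 := hgm.toLp with hG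
  have hGg : G =ᵐ[volume] g := hgm.coeFn_toLp
  -- Dilations here have norm at most 3, so the three errors below total 3ε/8 + ε/8 + ε/8 < ε.
  have hfG : ‖f - G‖ ≤ ε / 8 := by
    rw [Lp.norm_def]
    refine ENNReal.toReal_le_of_le_ofReal (by positivity) (le_trans (le_of_eq ?_) hgf)
    refine eLpNorm_congr_ae ?_
    filter_upwards [Lp.coeFn_sub f G, hGg] with x h1 h2
    rw [h1, Pi.sub_apply, Pi.sub_apply, h2]
  obtain ⟨R, hR⟩ := hgs.isCompact.isBounded.subset_closedBall (0 : R3)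
  obtain ⟨M, hM⟩ := hgc.bounded_above_of_compact_support hgs
  have hR' : ∀ x, R < ‖x‖ → g x = 0 := fun x hx => by
    by_contra h
    have := hR (subset_tsupport g h)
    rw [mem_closedBall_zero_iff] at this
    linarith
  have hG0 : Tendsto (fun n => ∫⁻ x, ‖g (r n • x) - g x‖ₑ ^ 2) atTop (𝓝 (∫⁻ _ : R3, 0)) := by
    refine tendsto_lintegral_filter_of_dominated_convergence
      -- Since every scale is at least 1/2, both g and its dilates vanish outside the ball of radius
      -- 2|R|.
      ((Metric.closedBall (0 : R3) (2 * |R|)).indicator fun _ => ENNReal.ofReal (2 * M) ^ 2)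
      (Eventually.of_forall fun n => ?_) (Eventually.of_forall fun n => ?_) ?_ ?_
    · have : Continuous fun x => g (r n • x) - g x := by fun_prop
      fun_prop
    · refine Eventually.of_forall fun x => ?_
      by_cases hx : x ∈ Metric.closedBall (0 : R3) (2 * |R|)
      · rw [Set.indicator_of_mem hx, ← ofReal_norm]
        gcongr
        calc _ ≤ ‖g (r n • x)‖ + ‖g x‖ := norm_sub_le _ _
          _ ≤ M + M := add_le_add (hM _) (hM _)
          _ = _ := by ring
      · rw [Set.indicator_of_notMem hx]
        rw [mem_closedBall_zero_iff, not_le] at hx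
        have hRa := le_abs_self R
        have hRn := abs_nonneg R
        have h1 : R < ‖x‖ := by linarith
        have h2 : R < ‖r n • x‖ := by
          rw [norm_smul, Real.norm_of_nonneg (hr n).le]
          nlinarith [hr' n, norm_nonneg x]
        simp [hR' _ h1, hR' _ h2]
    · rw [lintegral_indicator_const Metric.isClosed_closedBall.measurableSet]
      exact ENNReal.mul_ne_top (ENNReal.pow_ne_top ENNReal.ofReal_ne_top)
        measure_closedBall_lt_top.ne
    · refine Eventually.of_forall fun x => ?_
      have h1 : Tendsto (fun n => g (r n • x) - g x) atTop (𝓝 (g ((1 : ℝ) • x) - g x)) :=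
        ((hgc.tendsto _).comp (hlim.smul_const x)).sub_const _
      rw [one_smul, sub_self] at h1
      have h2 := ((ENNReal.continuous_pow 2).tendsto _).comp
        ((continuous_enorm.tendsto _).comp h1)
      simpa [Function.comp_def] using h2
  rw [lintegral_zero] at hG0
  have hev := hG0.eventually_lt_const
    (show (0 : ENNReal) < ENNReal.ofReal ((ε / 8) ^ 2) by simpa using by positivity)
  obtain ⟨N, hN⟩ := eventually_atTop.1 hev
  refine ⟨N, fun n hn => ?_⟩
  have hGn : ‖dilation (hr n) G - G‖ ≤ ε / 8 := by
    refine (sq_le_sq₀ (by positivity) (by positivity)).1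
      ((ENNReal.ofReal_le_ofReal_iff (by positivity)).1 ?_)
    rw [← lintegral_enorm_sq]
    refine le_trans (le_of_eq (lintegral_congr_ae ?_)) (hN n hn).le
    filter_upwards [Lp.coeFn_sub (dilation (hr n) G) G, coeFn_dilation (hr n) G, hGg,
      ae_comp_smul hGg (hr n)] with x h1 h2 h3 h4
    rw [h1, Pi.sub_apply, h2, h3, h4]
  rw [Real.dist_eq, sub_zero, abs_of_nonneg (norm_nonneg _)]
  calc ‖dilation (hr n) f - f‖
      = ‖dilation (hr n) (f - G) + (dilation (hr n) G - G) - (f - G)‖ := by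
        rw [dilation_sub]
        congr 1
        abel
    _ ≤ ‖dilation (hr n) (f - G)‖ + ‖dilation (hr n) G - G‖ + ‖f - G‖ :=
        (norm_sub_le _ _).trans (by gcongr; exact norm_add_le _ _)
    _ ≤ 3 * (ε / 8) + ε / 8 + ε / 8 := by
        gcongr
        exact (norm_dilation_le (hr n) (hr' n) _).trans (by gcongr)
    _ < ε := by linarith

/-! ### The energy symbol and the quadratic forms -/

/-- The symbol `√(|p|² + 1)`. -/
noncomputable def energySymbol (ξ : R3) : ℝ := √((2 * Real.pi * ‖ξ‖) ^ 2 + 1)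

lemma one_le_energySymbol (ξ : R3) : 1 ≤ energySymbol ξ :=
  Real.one_le_sqrt.2 (by linarith [sq_nonneg (2 * Real.pi * ‖ξ‖)])

lemma energySymbol_sq (ξ : R3) : energySymbol ξ ^ 2 = (2 * Real.pi * ‖ξ‖) ^ 2 + 1 :=
  Real.sq_sqrt (by positivity)

lemma kineticSymbol_eq (ξ : R3) : kineticSymbol ξ = energySymbol ξ - 1 := rfl

lemma continuous_energySymbol : Continuous energySymbol := by
  unfold energySymbol
  fun_prop

lemma continuous_kineticSymbol : Continuous kineticSymbol := by
  unfold kineticSymbol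
  fun_prop

/-- This comparison makes the form domain invariant under dilations, so dilated eigenfunctions are
admissible test functions. -/
lemma energySymbol_smul_le {r : ℝ} (hr : 0 < r) (ξ : R3) :
    energySymbol (r • ξ) ≤ (1 + r) * energySymbol ξ := by
  have h1 := energySymbol_sq ξ
  have h2 := energySymbol_sq (r • ξ)
  have h3 := one_le_energySymbol ξ
  refine (sq_le_sq₀ (by linarith [one_le_energySymbol (r • ξ)]) (by positivity)).1 ?_
  rw [mul_pow, h1, h2, norm_smul, Real.norm_of_nonneg hr.le]
  nlinarith [sq_nonneg (2 * Real.pi * ‖ξ‖), hr, sq_nonneg r]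

lemma memFormDomain_iff (ψ : L2R3) :
    MemFormDomain ψ ↔ Integrable fun ξ => energySymbol ξ * ‖(𝓕 ψ : L2R3) ξ‖ ^ 2 := Iff.rfl

/-- Integrability of `m |a| |b|` when `|m| ≤ C w` and `w |a|²`, `w |b|²` are integrable. -/
lemma integrable_mul_conj_mul {m : R3 → ℂ} {w : R3 → ℝ} {C : ℝ} {a b : R3 → ℂ}
    (hm : AEStronglyMeasurable m) (ha : AEStronglyMeasurable a) (hb : AEStronglyMeasurable b)
    (hmw : ∀ x, ‖m x‖ ≤ C * w x) (hwa : Integrable fun x => w x * ‖a x‖ ^ 2)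
    (hwb : Integrable fun x => w x * ‖b x‖ ^ 2) :
    Integrable fun x => m x * (conj (a x) * b x) := by
  refine Integrable.mono' ((hwa.add hwb).const_mul C)
    (hm.mul ((Complex.continuous_conj.comp_aestronglyMeasurable ha).mul hb))
    (Eventually.of_forall fun x => ?_)
  rw [norm_mul, norm_mul, RCLike.norm_conj]
  have h0 := (norm_nonneg _).trans (hmw x)
  calc ‖m x‖ * (‖a x‖ * ‖b x‖) ≤ (C * w x) * (‖a x‖ ^ 2 + ‖b x‖ ^ 2) := by
        gcongr
        · exact hmw x
        · nlinarith [sq_nonneg (‖a x‖ - ‖b x‖), sq_nonneg (‖a x‖), sq_nonneg (‖b x‖)]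
    _ = _ := by simp only [Pi.add_apply]; ring

lemma memFormDomain_dilation {r : ℝ} (hr : 0 < r) {ψ : L2R3} (hψ : MemFormDomain ψ) :
    MemFormDomain (dilation hr ψ) := by
  rw [memFormDomain_iff] at hψ ⊢
  have h1 := hψ.comp_smul (inv_pos.2 hr).ne'
  refine Integrable.mono' (h1.const_mul ((1 + r) * ((r ^ 3)⁻¹) ^ 2))
    (continuous_energySymbol.aestronglyMeasurable.mul
      ((Lp.memLp (𝓕 (dilation hr ψ))).1.norm.pow 2)) ?_
  filter_upwards [coeFn_fourier_dilation hr ψ] with ξ hξ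
  have h0 := one_le_energySymbol ξ
  rw [hξ, Real.norm_of_nonneg (by positivity), norm_mul, mul_pow, Complex.norm_real,
    Real.norm_of_nonneg (by positivity : (0 : ℝ) ≤ (r ^ 3)⁻¹)]
  have h2 := energySymbol_smul_le hr (r⁻¹ • ξ)
  rw [smul_inv_smul₀ hr.ne'] at h2
  calc _ ≤ (1 + r) * energySymbol (r⁻¹ • ξ) *
        (((r ^ 3)⁻¹) ^ 2 * ‖(𝓕 ψ : L2R3) (r⁻¹ • ξ)‖ ^ 2) := by
        gcongr
    _ = _ := by ring

lemma inner_eq_integral (f g : L2R3) : inner ℂ f g = ∫ x, conj (f x) * g x := by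
  rw [L2.inner_def]
  refine integral_congr_ae (Eventually.of_forall fun x => ?_)
  simp [mul_comm]

lemma norm_integral_mul_conj_mul_le {m : R3 → ℂ} {C : ℝ} (hC : ∀ x, ‖m x‖ ≤ C) (f g : L2R3) :
    ‖∫ x, m x * (conj (f x) * g x)‖ ≤ C * (‖f‖ * ‖g‖) := by
  have hC0 : 0 ≤ C := (norm_nonneg _).trans (hC 0)
  have h1 : ∫⁻ x, ‖f x‖ₑ * ‖g x‖ₑ ≤ ENNReal.ofReal (‖f‖ * ‖g‖) := by
    have h := ENNReal.lintegral_mul_le_Lp_mul_Lq volume Real.HolderConjugate.two_two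
      (measurable_coe_L2 f).enorm.aemeasurable (measurable_coe_L2 g).enorm.aemeasurable
    have hn : ∀ u : L2R3, (∫⁻ x, ‖u x‖ₑ ^ (2 : ℝ)) ^ (1 / 2 : ℝ) = ENNReal.ofReal ‖u‖ := fun u => by
      simp_rw [ENNReal.rpow_two]
      rw [lintegral_enorm_sq, ENNReal.ofReal_rpow_of_nonneg (by positivity) (by norm_num),
        ← Real.sqrt_eq_rpow, Real.sqrt_sq (norm_nonneg _)]
    rw [hn, hn, ← ENNReal.ofReal_mul (norm_nonneg _)] at h
    exact h
  have h2 : ‖∫ x, m x * (conj (f x) * g x)‖ₑ ≤ ENNReal.ofReal (C * (‖f‖ * ‖g‖)) := by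
    refine (enorm_integral_le_lintegral_enorm _).trans ?_
    calc ∫⁻ x, ‖m x * (conj (f x) * g x)‖ₑ ≤ ∫⁻ x, ENNReal.ofReal C * (‖f x‖ₑ * ‖g x‖ₑ) := by
          refine lintegral_mono fun x => ?_
          rw [enorm_mul, enorm_mul, RCLike.enorm_conj, ← ofReal_norm (m x)]
          gcongr
          exact hC x
      _ = ENNReal.ofReal C * ∫⁻ x, ‖f x‖ₑ * ‖g x‖ₑ :=
          lintegral_const_mul' _ _ ENNReal.ofReal_ne_top
      _ ≤ _ := by
          rw [ENNReal.ofReal_mul hC0]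
          gcongr
  rw [← ofReal_norm] at h2
  exact (ENNReal.ofReal_le_ofReal_iff (by positivity)).1 h2

lemma kineticForm_self (ψ : L2R3) :
    kineticForm ψ ψ = ((∫ ξ, kineticSymbol ξ * ‖(𝓕 ψ : L2R3) ξ‖ ^ 2 : ℝ) : ℂ) := by
  rw [kineticForm, ← integral_complex_ofReal]
  refine integral_congr_ae (Eventually.of_forall fun ξ => ?_)
  simp only
  rw [mul_comm (conj _), Complex.mul_conj, Complex.normSq_eq_norm_sq]
  push_cast
  rfl

lemma coulombForm_self (γ : ℝ) (ψ : L2R3) :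
    coulombForm γ ψ ψ = ((∫ x, γ / ‖x‖ * ‖ψ x‖ ^ 2 : ℝ) : ℂ) := by
  rw [coulombForm, ← integral_complex_ofReal]
  refine integral_congr_ae (Eventually.of_forall fun x => ?_)
  simp only
  rw [mul_comm (conj _), Complex.mul_conj, Complex.normSq_eq_norm_sq]
  push_cast
  rfl

/-! ### The virial theorem -/

/-- The weak form of the eigenvalue equation with a real eigenvalue. -/
def WeakEigen (γ e : ℝ) (ψ : L2R3) : Prop :=
  MemFormDomain ψ ∧ ∀ φ : L2R3, MemFormDomain φ →
    kineticForm φ ψ - coulombForm γ φ ψ = e * inner ℂ φ ψ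

/-- Testing with ψ itself exhibits E as a quotient of real numbers. -/
lemma IsEigenfunction.exists_weakEigen {γ : ℝ} {E : ℂ} {ψ : L2R3} (h : IsEigenfunction γ E ψ) :
    ∃ e : ℝ, E = e ∧ WeakEigen γ e ψ := by
  obtain ⟨h0, hdom, hform⟩ := h
  simp_rw [inner_smul_right] at hform
  have h1 := hform ψ hdom
  rw [kineticForm_self, coulombForm_self, inner_self_eq_norm_sq_to_K] at h1
  have hn : (‖ψ‖ : ℂ) ^ 2 ≠ 0 := by
    simpa using h0
  have hE : E = E.re := by
    have h2 : E = (((∫ ξ, kineticSymbol ξ * ‖(𝓕 ψ : L2R3) ξ‖ ^ 2) -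
        ∫ x, γ / ‖x‖ * ‖ψ x‖ ^ 2) / ‖ψ‖ ^ 2 : ℝ) := by
      push_cast
      rw [eq_div_iff hn]
      exact h1.symm
    rw [h2, Complex.ofReal_re]
  exact ⟨E.re, hE, hdom, fun φ hφ => by rw [hform φ hφ, ← hE]⟩

/-- The finite-difference form of the virial identity. -/
lemma WeakEigen.dilation_identity {γ e : ℝ} {ψ : L2R3} (h : WeakEigen γ e ψ) {r : ℝ} (hr : 0 < r) :
    ∫ ξ, ((r * kineticSymbol (r⁻¹ • ξ) - kineticSymbol ξ - (r - 1) * e : ℝ) : ℂ) *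
      (conj ((𝓕 ψ : L2R3) (r⁻¹ • ξ)) * (𝓕 ψ : L2R3) ξ) = 0 := by
  obtain ⟨hdom, hform⟩ := h
  have hr' := inv_pos.2 hr
  have hrc : (r : ℂ) ≠ 0 := by exact_mod_cast hr.ne'
  set u : L2R3 := 𝓕 ψ with hu
  set A₁ : ℂ := ∫ ξ, (kineticSymbol ξ : ℂ) * (conj (u (r⁻¹ • ξ)) * u ξ) with hA₁
  set A₂ : ℂ := ∫ ξ, (kineticSymbol (r⁻¹ • ξ) : ℂ) * (conj (u (r⁻¹ • ξ)) * u ξ) with hA₂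
  set B : ℂ := ∫ ξ, conj (u (r⁻¹ • ξ)) * u ξ with hB
  set C₁ : ℂ := ∫ x, ((γ / ‖x‖ : ℝ) : ℂ) * (conj (ψ (r • x)) * ψ x) with hC₁
  set S : ℂ := ∫ x, conj (ψ (r • x)) * ψ x with hS
  have hk1 : kineticForm (dilation hr ψ) ψ = ((r ^ 3)⁻¹ : ℝ) * A₁ := by
    rw [kineticForm, hA₁, ← integral_const_mul]
    refine integral_congr_ae ?_
    filter_upwards [coeFn_fourier_dilation hr ψ] with ξ hξ
    rw [hξ, map_mul, Complex.conj_ofReal]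
    ring
  have hc1 : coulombForm γ (dilation hr ψ) ψ = C₁ := by
    rw [coulombForm, hC₁]
    refine integral_congr_ae ?_
    filter_upwards [coeFn_dilation hr ψ] with x hx
    rw [hx]
  have hi1 : inner ℂ (dilation hr ψ) ψ = S := by
    rw [inner_eq_integral, hS]
    refine integral_congr_ae ?_
    filter_upwards [coeFn_dilation hr ψ] with x hx
    rw [hx]
  have hSB : S = ((r ^ 3)⁻¹ : ℝ) * B := by
    rw [← hi1, ← Lp.inner_fourier_eq, inner_eq_integral, hB, ← integral_const_mul]
    refine integral_congr_ae ?_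
    filter_upwards [coeFn_fourier_dilation hr ψ] with ξ hξ
    rw [hξ, map_mul, Complex.conj_ofReal]
    ring
  have hk2 : kineticForm (dilation hr' ψ) ψ = conj A₂ := by
    have h1 : kineticForm (dilation hr' ψ) ψ = ((r ^ 3 : ℝ) : ℂ) *
        ∫ ξ, (kineticSymbol ξ : ℂ) * (conj (u (r • ξ)) * u ξ) := by
      rw [kineticForm, ← integral_const_mul]
      refine integral_congr_ae ?_
      filter_upwards [coeFn_fourier_dilation hr' ψ] with ξ hξ
      rw [hξ, map_mul, Complex.conj_ofReal, inv_inv, inv_pow, inv_inv]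
      ring
    have h2 := integral_comp_smul_R3
      (fun ξ => (kineticSymbol ξ : ℂ) * (conj (u (r • ξ)) * u ξ)) hr'
    rw [inv_pow, inv_inv] at h2
    rw [h1, ← h2, hA₂, ← integral_conj]
    refine integral_congr_ae (Eventually.of_forall fun ξ => ?_)
    simp only [smul_inv_smul₀ hr.ne', map_mul, Complex.conj_conj, Complex.conj_ofReal]
    ring
  -- The change of variables contributes r³ and the homogeneity of 1/|x| contributes r⁻¹.
  have hc2 : coulombForm γ (dilation hr' ψ) ψ = (r ^ 2 : ℝ) * conj C₁ := by
    have h1 : coulombForm γ (dilation hr' ψ) ψ =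
        ∫ x, ((γ / ‖x‖ : ℝ) : ℂ) * (conj (ψ (r⁻¹ • x)) * ψ x) := by
      rw [coulombForm]
      refine integral_congr_ae ?_
      filter_upwards [coeFn_dilation hr' ψ] with x hx
      rw [hx]
    have h2 := integral_comp_smul_R3
      (fun x => ((γ / ‖x‖ : ℝ) : ℂ) * (conj (ψ (r⁻¹ • x)) * ψ x)) hr
    have h3 : ∫ x : R3, ((γ / ‖r • x‖ : ℝ) : ℂ) * (conj (ψ (r⁻¹ • r • x)) * ψ (r • x)) =
        (r⁻¹ : ℝ) * conj C₁ := by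
      rw [hC₁, ← integral_conj, ← integral_const_mul]
      refine integral_congr_ae (Eventually.of_forall fun x => ?_)
      simp only [inv_smul_smul₀ hr.ne', map_mul, Complex.conj_conj, Complex.conj_ofReal, norm_smul,
        Real.norm_of_nonneg hr.le]
      rw [div_mul_eq_div_div_swap, div_eq_mul_inv _ r]
      push_cast
      ring
    have h4 : coulombForm γ (dilation hr' ψ) ψ = (r ^ 3 : ℝ) * ((r⁻¹ : ℝ) * conj C₁) := by
      rw [h1, ← h3, h2, ← mul_assoc, ← Complex.ofReal_mul, mul_inv_cancel₀ (by positivity),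
        Complex.ofReal_one, one_mul]
    rw [h4]
    push_cast
    field_simp
  have hi2 : inner ℂ (dilation hr' ψ) ψ = (r ^ 3 : ℝ) * conj S := by
    have h1 : inner ℂ (dilation hr' ψ) ψ = ∫ x, conj (ψ (r⁻¹ • x)) * ψ x := by
      rw [inner_eq_integral]
      refine integral_congr_ae ?_
      filter_upwards [coeFn_dilation hr' ψ] with x hx
      rw [hx]
    have h2 := integral_comp_smul_R3 (fun x => conj (ψ (r⁻¹ • x)) * ψ x) hr
    have h3 : ∫ x : R3, conj (ψ (r⁻¹ • r • x)) * ψ (r • x) = conj S := by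
      rw [hS, ← integral_conj]
      refine integral_congr_ae (Eventually.of_forall fun x => ?_)
      simp only [inv_smul_smul₀ hr.ne', map_mul, Complex.conj_conj]
      ring
    rw [h1, ← h3, h2]
    push_cast
    field_simp
  have e1 := hform _ (memFormDomain_dilation hr hdom)
  have e2 := hform _ (memFormDomain_dilation hr' hdom)
  rw [hk1, hc1, hi1, hSB] at e1
  rw [hk2, hc2, hi2] at e2
  have e2' := congrArg conj e2
  simp only [map_sub, map_mul, Complex.conj_conj, Complex.conj_ofReal] at e2'
  rw [hSB] at e2'
  -- Dilating by r and by r⁻¹ gives two equations containing the same Coulomb integral C₁, up to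
  -- conjugation. This combination eliminates it, so only Fourier-side quantities remain.
  have key : r * A₂ - A₁ - (r - 1) * e * B = 0 := by
    push_cast at e1 e2'
    field_simp at e1 e2'
    linear_combination r * e2' - e1
  have hwu : Integrable fun ξ => energySymbol ξ * ‖u ξ‖ ^ 2 := hdom
  have hwv : Integrable fun ξ => energySymbol ξ * ‖u (r⁻¹ • ξ)‖ ^ 2 := by
    refine Integrable.mono' ((hwu.comp_smul hr'.ne').const_mul (1 + r))
      (continuous_energySymbol.aestronglyMeasurable.mul
        ((memLp_comp_smul u hr').1.norm.pow 2)) (Eventually.of_forall fun ξ => ?_)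
    have h2 := energySymbol_smul_le hr (r⁻¹ • ξ)
    rw [smul_inv_smul₀ hr.ne'] at h2
    have h3 := one_le_energySymbol ξ
    rw [Real.norm_of_nonneg (by positivity), ← mul_assoc]
    gcongr
  have hum : AEStronglyMeasurable u := (Lp.memLp u).1
  have hvm : AEStronglyMeasurable fun ξ => u (r⁻¹ • ξ) := (memLp_comp_smul u hr').1
  have hT : ∀ ξ, 0 ≤ kineticSymbol ξ := fun ξ => by
    rw [kineticSymbol_eq]
    linarith [one_le_energySymbol ξ]
  have i1 : Integrable fun ξ => (kineticSymbol ξ : ℂ) * (conj (u (r⁻¹ • ξ)) * u ξ) := by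
    refine integrable_mul_conj_mul (C := 1)
      (Complex.continuous_ofReal.comp continuous_kineticSymbol).aestronglyMeasurable hvm hum
      (fun ξ => ?_) hwv hwu
    rw [Complex.norm_real, Real.norm_of_nonneg (hT ξ), kineticSymbol_eq]
    linarith
  have i2 : Integrable fun ξ => (kineticSymbol (r⁻¹ • ξ) : ℂ) * (conj (u (r⁻¹ • ξ)) * u ξ) := by
    refine integrable_mul_conj_mul (C := 1 + r⁻¹)
      (Complex.continuous_ofReal.comp
        (continuous_kineticSymbol.comp (continuous_const_smul _))).aestronglyMeasurable hvm hum
      (fun ξ => ?_) hwv hwu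
    rw [Complex.norm_real, Real.norm_of_nonneg (hT _), kineticSymbol_eq]
    linarith [energySymbol_smul_le hr' ξ]
  have i3 : Integrable fun ξ => conj (u (r⁻¹ • ξ)) * u ξ := by
    have := integrable_mul_conj_mul (m := fun _ => 1) (C := 1) aestronglyMeasurable_const hvm hum
      (fun ξ => by simpa using one_le_energySymbol ξ) hwv hwu
    simpa using this
  have i4 : Integrable fun ξ => r * ((kineticSymbol (r⁻¹ • ξ) : ℂ) * (conj (u (r⁻¹ • ξ)) * u ξ)) -
      (kineticSymbol ξ : ℂ) * (conj (u (r⁻¹ • ξ)) * u ξ) := (i2.const_mul _).sub i1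
  rw [← key, hA₁, hA₂, hB, ← integral_const_mul, ← integral_const_mul,
    ← integral_sub (i2.const_mul _) i1, ← integral_sub i4 (i3.const_mul _)]
  refine integral_congr_ae (Eventually.of_forall fun ξ => ?_)
  push_cast
  ring

/-- The difference quotient at scale `r` of `r ↦ r T(p / r)`, where `T` is the kinetic symbol. -/
noncomputable def virialSymbol (r : ℝ) (ξ : R3) : ℝ :=
  (r + 1) / (√((2 * Real.pi * ‖ξ‖) ^ 2 + r ^ 2) + energySymbol ξ) - 1

/-- Since r√((p/r)² + 1) = √(p² + r²), rationalising the difference of square roots extracts the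
factor r - 1. -/
lemma mul_kineticSymbol_sub {r : ℝ} (hr : 0 < r) (ξ : R3) :
    r * kineticSymbol (r⁻¹ • ξ) - kineticSymbol ξ = (r - 1) * virialSymbol r ξ := by
  have h1 : r * energySymbol (r⁻¹ • ξ) = √((2 * Real.pi * ‖ξ‖) ^ 2 + r ^ 2) := by
    rw [energySymbol, norm_smul, Real.norm_of_nonneg (by positivity)]
    nth_rewrite 1 [← Real.sqrt_sq hr.le]
    rw [← Real.sqrt_mul (by positivity)]
    congr 1
    field_simp
  have hs := one_le_energySymbol ξ
  have h2 := energySymbol_sq ξ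
  rw [kineticSymbol_eq, kineticSymbol_eq, mul_sub, h1, virialSymbol]
  have h3 : √((2 * Real.pi * ‖ξ‖) ^ 2 + r ^ 2) ^ 2 = (2 * Real.pi * ‖ξ‖) ^ 2 + r ^ 2 :=
    Real.sq_sqrt (by positivity)
  have h4 : 0 ≤ √((2 * Real.pi * ‖ξ‖) ^ 2 + r ^ 2) := Real.sqrt_nonneg _
  set a := √((2 * Real.pi * ‖ξ‖) ^ 2 + r ^ 2)
  have h5 : a + energySymbol ξ ≠ 0 := by positivity
  field_simp
  linear_combination h3 - h2

/-- Uniformity in r and ξ allows the limit r → 1 with only ψ ∈ L², without differentiating ψ. -/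
lemma abs_virialSymbol_le {r : ℝ} (hr : 0 < r) (ξ : R3) : |virialSymbol r ξ| ≤ 1 := by
  have h1 : r ≤ √((2 * Real.pi * ‖ξ‖) ^ 2 + r ^ 2) :=
    Real.le_sqrt_of_sq_le (by linarith [sq_nonneg (2 * Real.pi * ‖ξ‖)])
  have hs := one_le_energySymbol ξ
  have h2 : 0 ≤ (r + 1) / (√((2 * Real.pi * ‖ξ‖) ^ 2 + r ^ 2) + energySymbol ξ) := by positivity
  have h3 : (r + 1) / (√((2 * Real.pi * ‖ξ‖) ^ 2 + r ^ 2) + energySymbol ξ) ≤ 1 :=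
    (div_le_one (by linarith)).2 (by linarith)
  rw [virialSymbol, abs_le]
  constructor <;> linarith

lemma continuous_virialSymbol {r : ℝ} (hr : 0 < r) : Continuous (virialSymbol r) := by
  unfold virialSymbol
  refine (Continuous.div (by fun_prop) ?_ fun ξ => ?_).sub continuous_const
  · exact (by fun_prop : Continuous fun ξ : R3 =>
      √((2 * Real.pi * ‖ξ‖) ^ 2 + r ^ 2)).add continuous_energySymbol
  · have := one_le_energySymbol ξ
    positivity

lemma tendsto_virialSymbol {r : ℕ → ℝ} (hr : Tendsto r atTop (𝓝 1)) (ξ : R3) :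
    Tendsto (fun n => virialSymbol (r n) ξ) atTop (𝓝 ((energySymbol ξ)⁻¹ - 1)) := by
  have hs := one_le_energySymbol ξ
  have hc : ContinuousAt (fun t : ℝ => virialSymbol t ξ) 1 := by
    unfold virialSymbol
    refine ContinuousAt.sub (ContinuousAt.div (by fun_prop) (by fun_prop) ?_) continuousAt_const
    positivity
  have h1 : virialSymbol 1 ξ = (energySymbol ξ)⁻¹ - 1 := by
    have : √((2 * Real.pi * ‖ξ‖) ^ 2 + 1 ^ 2) = energySymbol ξ := by rw [one_pow]; rfl
    rw [virialSymbol, this]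
    field_simp
  rw [← h1]
  exact hc.tendsto.comp hr

/-- The virial theorem for the Chandrasekhar operator. -/
theorem WeakEigen.virial {γ e : ℝ} {ψ : L2R3} (h : WeakEigen γ e ψ) :
    ∫ ξ, (1 - (energySymbol ξ)⁻¹) * ‖(𝓕 ψ : L2R3) ξ‖ ^ 2 = -e * ‖ψ‖ ^ 2 := by
  set u : L2R3 := 𝓕 ψ with hu
  -- Scales in (1, 2]: the factor r - 1 can be cancelled, and the inverses stay above 1/2 as
  -- `tendsto_dilation` requires.
  set r : ℕ → ℝ := fun n => 1 + 1 / ((n : ℝ) + 1) with hr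
  have hr1 : ∀ n, 1 < r n := fun n => by
    have : (0 : ℝ) < 1 / ((n : ℝ) + 1) := by positivity
    simp only [hr]
    linarith
  have hr2 : ∀ n, r n ≤ 2 := fun n => by
    have : 1 / ((n : ℝ) + 1) ≤ 1 := (div_le_one (by positivity)).2 (by linarith [n.cast_nonneg (α := ℝ)])
    simp only [hr]
    linarith
  have hr0 : ∀ n, 0 < r n := fun n => one_pos.trans (hr1 n)
  have hlim : Tendsto r atTop (𝓝 1) := by
    have := (tendsto_one_div_add_atTop_nhds_zero_nat (𝕜 := ℝ)).const_add 1
    simpa [hr] using this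
  have hri : ∀ n, 0 < (r n)⁻¹ := fun n => inv_pos.2 (hr0 n)
  have hri2 : ∀ n, 1 / 2 ≤ (r n)⁻¹ := fun n => by
    rw [one_div]
    exact inv_anti₀ (hr0 n) (hr2 n)
  have hilim : Tendsto (fun n => (r n)⁻¹) atTop (𝓝 1) := by
    simpa using hlim.inv₀ one_ne_zero
  set m : ℕ → R3 → ℂ := fun n ξ => ((virialSymbol (r n) ξ - e : ℝ) : ℂ) with hm
  have hmb : ∀ n ξ, ‖m n ξ‖ ≤ 1 + |e| := fun n ξ => by
    rw [hm, Complex.norm_real]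
    exact (norm_sub_le _ _).trans (add_le_add (abs_virialSymbol_le (hr0 n) ξ) le_rfl)
  have hmm : ∀ n, AEStronglyMeasurable (m n) := fun n =>
    (Complex.continuous_ofReal.comp
      ((continuous_virialSymbol (hr0 n)).sub continuous_const)).aestronglyMeasurable
  have hint : ∀ n (a b : L2R3), Integrable fun ξ => m n ξ * (conj (a ξ) * b ξ) := fun n a b =>
    integrable_mul_conj_mul (w := fun _ => 1) (C := 1 + |e|) (hmm n) (Lp.memLp a).1 (Lp.memLp b).1
      (by simpa using hmb n) (by simpa using integrable_norm_sq a)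
      (by simpa using integrable_norm_sq b)
  have hzero : ∀ n, ∫ ξ, m n ξ * (conj (dilation (hri n) u ξ) * u ξ) = 0 := fun n => by
    have h1 := h.dilation_identity (hr0 n)
    have h2 : ∫ ξ, ((r n * kineticSymbol ((r n)⁻¹ • ξ) - kineticSymbol ξ - (r n - 1) * e : ℝ) : ℂ) *
      (conj (u ((r n)⁻¹ • ξ)) * u ξ) =
        ((r n - 1 : ℝ) : ℂ) * ∫ ξ, m n ξ * (conj (dilation (hri n) u ξ) * u ξ) := by
      rw [← integral_const_mul]
      refine integral_congr_ae ?_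
      filter_upwards [coeFn_dilation (hri n) u] with ξ hξ
      rw [mul_kineticSymbol_sub (hr0 n), hξ, hm]
      push_cast
      ring
    rw [h2] at h1
    refine (mul_eq_zero.1 h1).resolve_left ?_
    exact_mod_cast (sub_pos.2 (hr1 n)).ne'
  -- The integral with one dilated factor vanishes. Undoing the dilation changes it by O(‖dilated u
  -- - u‖), so the undilated integrals tend to 0; dominated convergence identifies the same limit
  -- with the virial integral.
  have hsmall : Tendsto (fun n => ∫ ξ, m n ξ * (conj (u ξ) * u ξ)) atTop (𝓝 0) := by
    have h1 : ∀ n, ‖∫ ξ, m n ξ * (conj (u ξ) * u ξ)‖ ≤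
        (1 + |e|) * (‖dilation (hri n) u - u‖ * ‖u‖) := fun n => by
      have h2 := norm_integral_mul_conj_mul_le (hmb n) (dilation (hri n) u - u) u
      have h3 : ∫ ξ, m n ξ * (conj ((dilation (hri n) u - u : L2R3) ξ) * u ξ) =
          (∫ ξ, m n ξ * (conj (dilation (hri n) u ξ) * u ξ)) -
          ∫ ξ, m n ξ * (conj (u ξ) * u ξ) := by
        rw [← integral_sub (hint n _ _) (hint n _ _)]
        refine integral_congr_ae ?_
        filter_upwards [Lp.coeFn_sub (dilation (hri n) u) u] with ξ hξ
        rw [hξ, Pi.sub_apply, map_sub]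
        ring
      rw [h3, hzero, zero_sub, norm_neg] at h2
      exact h2
    refine squeeze_zero_norm h1 ?_
    have h4 := ((tendsto_dilation hri hri2 hilim u).mul_const ‖u‖).const_mul (1 + |e|)
    simpa using h4
  have hDCT : Tendsto (fun n => ∫ ξ, m n ξ * (conj (u ξ) * u ξ)) atTop
      (𝓝 (∫ ξ, (((energySymbol ξ)⁻¹ - 1 - e : ℝ) : ℂ) * (conj (u ξ) * u ξ))) := by
    refine tendsto_integral_of_dominated_convergence (fun ξ => (1 + |e|) * ‖u ξ‖ ^ 2)
      (fun n => (hint n u u).1) ((integrable_norm_sq u).const_mul _)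
      (fun n => Eventually.of_forall fun ξ => ?_) (Eventually.of_forall fun ξ => ?_)
    · rw [norm_mul, norm_mul, RCLike.norm_conj, ← sq]
      gcongr
      exact hmb n ξ
    · refine Tendsto.mul_const _ ?_
      exact (Complex.continuous_ofReal.tendsto _).comp ((tendsto_virialSymbol hlim ξ).sub_const e)
  have hlast := tendsto_nhds_unique hDCT hsmall
  have hreal : ∫ ξ, ((energySymbol ξ)⁻¹ - 1 - e) * ‖u ξ‖ ^ 2 = 0 := by
    rw [← Complex.ofReal_inj, ← integral_complex_ofReal, Complex.ofReal_zero, ← hlast]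
    refine integral_congr_ae (Eventually.of_forall fun ξ => ?_)
    simp only
    rw [mul_comm (conj _), Complex.mul_conj, Complex.normSq_eq_norm_sq]
    push_cast
    ring
  have hK : Integrable fun ξ => (1 - (energySymbol ξ)⁻¹) * ‖u ξ‖ ^ 2 := by
    refine (integrable_norm_sq u).bdd_mul (c := 1) ?_ (Eventually.of_forall fun ξ => ?_)
    · exact (continuous_const.sub (continuous_energySymbol.inv₀ fun ξ =>
        (one_pos.trans_le (one_le_energySymbol ξ)).ne')).aestronglyMeasurable
    · have h1 := one_le_energySymbol ξ
      have h2 : (energySymbol ξ)⁻¹ ≤ 1 := inv_le_one_of_one_le₀ h1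
      have h3 : 0 < (energySymbol ξ)⁻¹ := by positivity
      rw [Real.norm_eq_abs, abs_le]
      constructor <;> linarith
  have hsplit : ∫ ξ, ((energySymbol ξ)⁻¹ - 1 - e) * ‖u ξ‖ ^ 2 =
      -(∫ ξ, (1 - (energySymbol ξ)⁻¹) * ‖u ξ‖ ^ 2) - e * ∫ ξ, ‖u ξ‖ ^ 2 := by
    have hKn : Integrable fun ξ => -((1 - (energySymbol ξ)⁻¹) * ‖u ξ‖ ^ 2) := hK.neg
    rw [← integral_neg, ← integral_const_mul, ← integral_sub hKn
      ((integrable_norm_sq u).const_mul e)]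
    refine integral_congr_ae (Eventually.of_forall fun ξ => ?_)
    simp only
    ring
  rw [hsplit, integral_norm_sq, hu, Lp.norm_fourier_eq] at hreal
  linarith

/-! ### Kato's inequality for real integrals on the form domain -/

lemma integrable_and_integral_le_of_lintegral_le {g h : R3 → ℝ} (hgm : AEStronglyMeasurable g)
    (hg0 : ∀ x, 0 ≤ g x) (hh0 : ∀ x, 0 ≤ h x) (hh : Integrable h)
    (hle : ∫⁻ x, ENNReal.ofReal (g x) ≤ ∫⁻ x, ENNReal.ofReal (h x)) :
    Integrable g ∧ ∫ x, g x ≤ ∫ x, h x := by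
  rw [← ofReal_integral_eq_lintegral_ofReal hh (Eventually.of_forall hh0)] at hle
  have hg : Integrable g := by
    refine ⟨hgm, ?_⟩
    rw [hasFiniteIntegral_iff_ofReal (Eventually.of_forall hg0)]
    exact hle.trans_lt ENNReal.ofReal_lt_top
  refine ⟨hg, ?_⟩
  rw [← ofReal_integral_eq_lintegral_ofReal hg (Eventually.of_forall hg0)] at hle
  exact (ENNReal.ofReal_le_ofReal_iff (integral_nonneg hh0)).1 hle

lemma two_pi_norm_le_energySymbol (ξ : R3) : 2 * Real.pi * ‖ξ‖ ≤ energySymbol ξ :=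
  Real.le_sqrt_of_sq_le (by linarith)

lemma integrable_mul_norm_sq_of_le {ψ : L2R3} (hψ : MemFormDomain ψ) {m : R3 → ℝ}
    (hm : Continuous m) (hmle : ∀ ξ, |m ξ| ≤ energySymbol ξ) :
    Integrable fun ξ => m ξ * ‖(𝓕 ψ : L2R3) ξ‖ ^ 2 := by
  refine Integrable.mono' ((memFormDomain_iff ψ).1 hψ)
    (hm.aestronglyMeasurable.mul ((Lp.memLp (𝓕 ψ)).1.norm.pow 2)) (Eventually.of_forall fun ξ => ?_)
  rw [norm_mul, Real.norm_eq_abs, Real.norm_of_nonneg (by positivity)]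
  gcongr
  exact hmle ξ

/-- Kato's inequality on the form domain. -/
lemma integrable_coulomb {γ : ℝ} (hγ : 0 ≤ γ) {ψ : L2R3} (hψ : MemFormDomain ψ) :
    Integrable (fun x => γ / ‖x‖ * ‖ψ x‖ ^ 2) ∧ ∫ x, γ / ‖x‖ * ‖ψ x‖ ^ 2 ≤
      γ * Real.pi / 2 * ∫ ξ, 2 * Real.pi * ‖ξ‖ * ‖(𝓕 ψ : L2R3) ξ‖ ^ 2 := by
  have hpi := Real.pi_pos
  have hi : Integrable fun ξ => 2 * Real.pi * ‖ξ‖ * ‖(𝓕 ψ : L2R3) ξ‖ ^ 2 :=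
    integrable_mul_norm_sq_of_le hψ (by fun_prop) fun ξ => by
      rw [abs_of_nonneg (by positivity)]
      exact two_pi_norm_le_energySymbol ξ
  have hmψ := measurable_coe_L2 ψ
  have h := integrable_and_integral_le_of_lintegral_le (g := fun x => 2 / (Real.pi * ‖x‖) * ‖ψ x‖ ^ 2)
    (by fun_prop) (fun x => by positivity) (fun x => by positivity) hi (by
      have hk := kato_inequality ψ
      convert hk using 3 with x ξ
      · rw [mul_comm, ENNReal.ofReal_mul (by positivity), ENNReal.ofReal_pow (norm_nonneg _),
          ofReal_norm]
      · rw [ENNReal.ofReal_mul (by positivity), ENNReal.ofReal_pow (norm_nonneg _), ofReal_norm])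
  have e : (fun x => γ / ‖x‖ * ‖ψ x‖ ^ 2) =
      fun x => γ * Real.pi / 2 * (2 / (Real.pi * ‖x‖) * ‖ψ x‖ ^ 2) := by
    ext x
    rcases eq_or_ne ‖x‖ 0 with h0 | h0
    · simp [h0]
    · field_simp
  rw [e]
  refine ⟨h.1.const_mul _, ?_⟩
  rw [integral_const_mul]
  exact mul_le_mul_of_nonneg_left h.2 (by positivity)

/-! ### Splitting into high and low frequencies -/

/-- The set of frequencies with `|p| ≥ 1`. -/
def highFrequency : Set R3 := {ξ | 1 ≤ 2 * Real.pi * ‖ξ‖}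

lemma measurableSet_highFrequency : MeasurableSet highFrequency :=
  measurableSet_le measurable_const (by fun_prop)

lemma memLp_indicator_highFrequency (f : L2R3) :
    MemLp (highFrequency.indicator f) 2 (volume : Measure R3) :=
  (Lp.memLp f).indicator measurableSet_highFrequency

/-- The restriction of a function to `|p| ≥ 1`. -/
noncomputable def highCutoff (f : L2R3) : L2R3 :=
  MemLp.toLp (highFrequency.indicator f) (memLp_indicator_highFrequency f)

/-- The part of `ψ` with frequencies in `|p| ≥ 1`. -/
noncomputable def highPart (ψ : L2R3) : L2R3 :=
  (Lp.fourierTransformₗᵢ R3 ℂ).symm (highCutoff (𝓕 ψ))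

lemma coeFn_fourier_highPart (ψ : L2R3) :
    (𝓕 (highPart ψ) : L2R3) =ᵐ[volume] highFrequency.indicator (𝓕 ψ : L2R3) := by
  have h : (𝓕 (highPart ψ) : L2R3) = highCutoff (𝓕 ψ) :=
    (Lp.fourierTransformₗᵢ R3 ℂ).apply_symm_apply _
  rw [h]
  exact MemLp.coeFn_toLp _

lemma coeFn_fourier_sub_highPart (ψ : L2R3) :
    (𝓕 (ψ - highPart ψ) : L2R3) =ᵐ[volume] highFrequencyᶜ.indicator (𝓕 ψ : L2R3) := by
  have h : (𝓕 (ψ - highPart ψ) : L2R3) = 𝓕 ψ - 𝓕 (highPart ψ) :=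
    (Lp.fourierTransformₗᵢ R3 ℂ).map_sub _ _
  rw [h]
  filter_upwards [Lp.coeFn_sub (𝓕 ψ) (𝓕 (highPart ψ)), coeFn_fourier_highPart ψ] with ξ h1 h2
  rw [h1, Pi.sub_apply, h2]
  by_cases hξ : ξ ∈ highFrequency <;> simp [hξ]

lemma memFormDomain_of_norm_le {φ ψ : L2R3} (hψ : MemFormDomain ψ)
    (hle : ∀ᵐ ξ, ‖(𝓕 φ : L2R3) ξ‖ ≤ ‖(𝓕 ψ : L2R3) ξ‖) : MemFormDomain φ := by
  rw [memFormDomain_iff] at hψ ⊢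
  refine Integrable.mono' hψ (continuous_energySymbol.aestronglyMeasurable.mul
    ((Lp.memLp (𝓕 φ)).1.norm.pow 2)) ?_
  filter_upwards [hle] with ξ hξ
  have h0 := one_le_energySymbol ξ
  rw [Real.norm_of_nonneg (by positivity)]
  gcongr

lemma memFormDomain_highPart {ψ : L2R3} (hψ : MemFormDomain ψ) : MemFormDomain (highPart ψ) := by
  refine memFormDomain_of_norm_le hψ ?_
  filter_upwards [coeFn_fourier_highPart ψ] with ξ hξ
  rw [hξ]
  exact norm_indicator_le_norm_self _ _

lemma memFormDomain_sub_highPart {ψ : L2R3} (hψ : MemFormDomain ψ) :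
    MemFormDomain (ψ - highPart ψ) := by
  refine memFormDomain_of_norm_le hψ ?_
  filter_upwards [coeFn_fourier_sub_highPart ψ] with ξ hξ
  rw [hξ]
  exact norm_indicator_le_norm_self _ _

lemma integral_mul_norm_sq_of_indicator {v u : R3 → ℂ} {S : Set R3} (hS : MeasurableSet S)
    (h : v =ᵐ[volume] S.indicator u) (m : R3 → ℝ) :
    ∫ ξ, m ξ * ‖v ξ‖ ^ 2 = ∫ ξ in S, m ξ * ‖u ξ‖ ^ 2 := by
  rw [← integral_indicator hS]
  refine integral_congr_ae ?_
  filter_upwards [h] with ξ hξ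
  rw [hξ]
  by_cases hm : ξ ∈ S <;> simp [hm]

lemma sqrt_two_le_energySymbol {ξ : R3} (hξ : ξ ∈ highFrequency) : √2 ≤ energySymbol ξ := by
  have h : (1 : ℝ) ≤ 2 * Real.pi * ‖ξ‖ := hξ
  exact Real.sqrt_le_sqrt (by nlinarith)

lemma energySymbol_le_sqrt_two {ξ : R3} (hξ : ξ ∈ highFrequencyᶜ) : energySymbol ξ ≤ √2 := by
  have h : 2 * Real.pi * ‖ξ‖ < 1 := not_le.1 hξ
  have h0 : 0 ≤ 2 * Real.pi * ‖ξ‖ := by positivity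
  exact Real.sqrt_le_sqrt (by nlinarith)

lemma sqrt_two_div_eq : √2 / (√2 - 1) = √2 * (√2 + 1) := by
  have h : √2 ^ 2 = 2 := Real.sq_sqrt zero_le_two
  have h1 : (1 : ℝ) < √2 := Real.lt_sqrt_of_sq_lt (by norm_num)
  rw [div_eq_iff (by linarith)]
  linear_combination (-√2) * h

/-- The weight 1 - 1/s increases with |p| and equals 1/κ at |p| = 1, where κ = √2/(√2 - 1). This
lets the virial identity control the L² mass at high frequency. -/
lemma one_le_mul_of_mem_highFrequency {ξ : R3} (hξ : ξ ∈ highFrequency) :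
    1 ≤ √2 / (√2 - 1) * (1 - (energySymbol ξ)⁻¹) := by
  have h1 : (1 : ℝ) < √2 := Real.lt_sqrt_of_sq_lt (by norm_num)
  have h2 : (energySymbol ξ)⁻¹ ≤ (√2)⁻¹ :=
    inv_anti₀ (by linarith) (sqrt_two_le_energySymbol hξ)
  have h3 : 0 < √2 - 1 := by linarith
  calc (1 : ℝ) = √2 / (√2 - 1) * (1 - (√2)⁻¹) := by field_simp
    _ ≤ _ := by gcongr

/-- Replaces |p| in Kato's inequality by the kinetic symbol plus a multiple of the virial weight, so
the kinetic term can be absorbed. -/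
lemma two_pi_norm_le_of_mem_highFrequency {ξ : R3} (hξ : ξ ∈ highFrequency) :
    2 * Real.pi * ‖ξ‖ ≤ kineticSymbol ξ + 2 * (1 - (energySymbol ξ)⁻¹) := by
  have hp : (1 : ℝ) ≤ 2 * Real.pi * ‖ξ‖ := hξ
  have hs := one_le_energySymbol ξ
  have hsq := energySymbol_sq ξ
  have hps := two_pi_norm_le_energySymbol ξ
  rw [kineticSymbol_eq]
  generalize 2 * Real.pi * ‖ξ‖ = p at *
  generalize energySymbol ξ = s at *
  -- This quotient is the difference of the two sides, by s - p = 1/(s + p); its sign uses p ≥ 1.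
  have h1 : 0 ≤ (s * (p - 1) + (p - 1) ^ 2) / (s * (s + p)) := by
    have : 0 ≤ p - 1 := by linarith
    positivity
  have h2 : (s * (p - 1) + (p - 1) ^ 2) / (s * (s + p)) = s - 1 + 2 * (1 - s⁻¹) - p := by
    field_simp
    linear_combination (-1 - s) * hsq
  linarith

lemma kineticSymbol_le_of_notMem_highFrequency {ξ : R3} (hξ : ξ ∈ highFrequencyᶜ) :
    kineticSymbol ξ ≤ 2 * (1 - (energySymbol ξ)⁻¹) := by
  have h1 := one_le_energySymbol ξ
  have h2 : energySymbol ξ ≤ 2 := (energySymbol_le_sqrt_two hξ).trans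
    (Real.sqrt_le_iff.2 (by norm_num))
  rw [kineticSymbol_eq]
  generalize energySymbol ξ = s at *
  have h3 : 0 ≤ (s - 1) * (2 - s) / s :=
    div_nonneg (mul_nonneg (by linarith) (by linarith)) (by linarith)
  have h4 : (s - 1) * (2 - s) / s = 2 * (1 - s⁻¹) - (s - 1) := by
    field_simp
  linarith

/-- From p² = s² - 1 = s(s + 1)(1 - 1/s) and s ≤ √2. The constant √2(√2 + 1) is the same κ as at
high frequency, so both halves of the cross term combine into one virial integral. -/
lemma sq_le_of_notMem_highFrequency {ξ : R3} (hξ : ξ ∈ highFrequencyᶜ) :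
    (2 * Real.pi * ‖ξ‖) ^ 2 ≤ √2 / (√2 - 1) * (1 - (energySymbol ξ)⁻¹) := by
  have h1 := one_le_energySymbol ξ
  have h2 := energySymbol_le_sqrt_two hξ
  have h3 : (energySymbol ξ)⁻¹ ≤ 1 := inv_le_one_of_one_le₀ h1
  rw [sqrt_two_div_eq, ← sub_eq_iff_eq_add.2 (energySymbol_sq ξ)]
  have h4 : energySymbol ξ ^ 2 - 1 =
      energySymbol ξ * (energySymbol ξ + 1) * (1 - (energySymbol ξ)⁻¹) := by
    field_simp
    ring
  rw [h4]
  have : 0 ≤ 1 - (energySymbol ξ)⁻¹ := by linarith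
  gcongr

lemma virialWeight_nonneg (ξ : R3) : 0 ≤ 1 - (energySymbol ξ)⁻¹ :=
  sub_nonneg.2 (inv_le_one_of_one_le₀ (one_le_energySymbol ξ))

lemma continuous_virialWeight : Continuous fun ξ => 1 - (energySymbol ξ)⁻¹ :=
  continuous_const.sub (continuous_energySymbol.inv₀ fun ξ =>
    (one_pos.trans_le (one_le_energySymbol ξ)).ne')

lemma integrable_virialWeight {ψ : L2R3} (hψ : MemFormDomain ψ) :
    Integrable fun ξ => (1 - (energySymbol ξ)⁻¹) * ‖(𝓕 ψ : L2R3) ξ‖ ^ 2 :=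
  integrable_mul_norm_sq_of_le hψ continuous_virialWeight fun ξ => by
    have h1 := one_le_energySymbol ξ
    have : 0 < (energySymbol ξ)⁻¹ := by positivity
    rw [abs_of_nonneg (virialWeight_nonneg ξ)]
    linarith

lemma integrable_kineticSymbol {ψ : L2R3} (hψ : MemFormDomain ψ) :
    Integrable fun ξ => kineticSymbol ξ * ‖(𝓕 ψ : L2R3) ξ‖ ^ 2 :=
  integrable_mul_norm_sq_of_le hψ continuous_kineticSymbol fun ξ => by
    have h1 := one_le_energySymbol ξ
    rw [kineticSymbol_eq, abs_of_nonneg (by linarith)]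
    linarith

/-- Hardy's inequality for the low-frequency part. -/
lemma hardy_lowPart {ψ : L2R3} (hψ : MemFormDomain ψ) :
    Integrable (fun x => 1 / ‖x‖ ^ 2 * ‖(ψ - highPart ψ : L2R3) x‖ ^ 2) ∧
    ∫ x, 1 / ‖x‖ ^ 2 * ‖(ψ - highPart ψ : L2R3) x‖ ^ 2 ≤ 4 * (√2 / (√2 - 1)) *
      ∫ ξ in highFrequencyᶜ, (1 - (energySymbol ξ)⁻¹) * ‖(𝓕 ψ : L2R3) ξ‖ ^ 2 := by
  have hk : 0 ≤ √2 / (√2 - 1) := by rw [sqrt_two_div_eq]; positivity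
  set φ : L2R3 := ψ - highPart ψ with hφ
  have hmφ := measurable_coe_L2 φ
  have hφd : MemFormDomain φ := memFormDomain_sub_highPart hψ
  have hi := (integrable_virialWeight hφd).const_mul (4 * (√2 / (√2 - 1)))
  have h := integrable_and_integral_le_of_lintegral_le (g := fun x => 1 / ‖x‖ ^ 2 * ‖φ x‖ ^ 2)
    (by fun_prop) (fun x => by positivity)
    (fun ξ => mul_nonneg (by positivity) (mul_nonneg (virialWeight_nonneg ξ) (by positivity))) hi (by
      calc ∫⁻ x, ENNReal.ofReal (1 / ‖x‖ ^ 2 * ‖φ x‖ ^ 2)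
          = ∫⁻ x, ‖φ x‖ₑ ^ 2 * ENNReal.ofReal (1 / ‖x‖ ^ 2) := by
            refine lintegral_congr fun x => ?_
            rw [mul_comm, ENNReal.ofReal_mul (by positivity), ENNReal.ofReal_pow (norm_nonneg _),
              ofReal_norm]
        _ ≤ 4 * ∫⁻ ξ, ENNReal.ofReal ((2 * Real.pi * ‖ξ‖) ^ 2) * ‖(𝓕 φ : L2R3) ξ‖ₑ ^ 2 :=
            hardy_inequality φ
        _ ≤ _ := by
            rw [← lintegral_const_mul' _ _ ENNReal.ofNat_ne_top]
            refine lintegral_mono_ae ?_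
            filter_upwards [coeFn_fourier_sub_highPart ψ] with ξ hξ
            rw [hξ, ← ofReal_norm, ← ENNReal.ofReal_pow (norm_nonneg _),
              ← ENNReal.ofReal_mul (by positivity), ← ENNReal.ofReal_ofNat 4,
              ← ENNReal.ofReal_mul (by positivity)]
            refine ENNReal.ofReal_le_ofReal ?_
            by_cases hm : ξ ∈ highFrequencyᶜ
            · rw [mul_assoc 4, ← mul_assoc (√2 / (√2 - 1))]
              gcongr
              exact sq_le_of_notMem_highFrequency hm
            · simp [Set.indicator_of_notMem hm])
  refine ⟨h.1, h.2.trans (le_of_eq ?_)⟩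
  rw [integral_const_mul, integral_mul_norm_sq_of_indicator measurableSet_highFrequency.compl
    (coeFn_fourier_sub_highPart ψ)]

/-- The cross term between the high- and low-frequency parts. -/
lemma norm_coulombForm_highPart_le {γ : ℝ} (hγ : 0 ≤ γ) {ψ : L2R3} (hψ : MemFormDomain ψ) :
    ‖coulombForm γ (highPart ψ) (ψ - highPart ψ)‖ ≤ γ * (√2 / (√2 - 1)) *
      ∫ ξ, (1 - (energySymbol ξ)⁻¹) * ‖(𝓕 ψ : L2R3) ξ‖ ^ 2 := by
  set φ : L2R3 := ψ - highPart ψ with hφ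
  have hH := hardy_lowPart hψ
  rw [← hφ] at hH
  have hi := integrable_virialWeight hψ
  have hn : ∫ x, ‖highPart ψ x‖ ^ 2 ≤ √2 / (√2 - 1) *
      ∫ ξ in highFrequency, (1 - (energySymbol ξ)⁻¹) * ‖(𝓕 ψ : L2R3) ξ‖ ^ 2 := by
    have h1 := integral_mul_norm_sq_of_indicator measurableSet_highFrequency
      (coeFn_fourier_highPart ψ) (fun _ => 1)
    simp only [one_mul] at h1
    rw [integral_norm_sq, ← Lp.norm_fourier_eq, ← integral_norm_sq, h1, ← integral_const_mul]
    refine setIntegral_mono_on (integrable_norm_sq _).integrableOn (hi.const_mul _).integrableOn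
      measurableSet_highFrequency fun ξ hξ => ?_
    rw [← mul_assoc]
    exact le_mul_of_one_le_left (by positivity) (one_le_mul_of_mem_highFrequency hξ)
  -- From ab ≤ a² + b²/4 with b = |φ|/|x|: the 1/4 cancels the Hardy constant 4, so both parts carry
  -- the factor κ.
  have hb : Integrable fun x => γ * (‖highPart ψ x‖ ^ 2 + 1 / 4 * (1 / ‖x‖ ^ 2 * ‖φ x‖ ^ 2)) :=
    ((integrable_norm_sq _).add (hH.1.const_mul _)).const_mul _
  have h1 : ‖coulombForm γ (highPart ψ) φ‖ ≤
      ∫ x, γ * (‖highPart ψ x‖ ^ 2 + 1 / 4 * (1 / ‖x‖ ^ 2 * ‖φ x‖ ^ 2)) := by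
    refine norm_integral_le_of_norm_le hb (Eventually.of_forall fun x => ?_)
    rw [norm_mul, norm_mul, RCLike.norm_conj, Complex.norm_real,
      Real.norm_of_nonneg (by positivity), div_eq_mul_inv, mul_assoc]
    gcongr
    rw [one_div (‖x‖ ^ 2), ← inv_pow]
    nlinarith [sq_nonneg (‖highPart ψ x‖ - 1 / 2 * (‖x‖⁻¹ * ‖φ x‖))]
  rw [integral_const_mul, integral_add (integrable_norm_sq _) (hH.1.const_mul _),
    integral_const_mul] at h1
  rw [← integral_add_compl measurableSet_highFrequency hi]
  refine h1.trans ?_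
  rw [mul_assoc]
  gcongr
  linarith [hH.2]

/-- Splitting the integral requires integrability of each piece, which Kato's inequality supplies on
the form domain. -/
lemma coulombForm_highPart {γ : ℝ} (hγ : 0 ≤ γ) {ψ : L2R3} (hψ : MemFormDomain ψ) :
    coulombForm γ (highPart ψ) ψ = coulombForm γ (highPart ψ) (highPart ψ) +
      coulombForm γ (highPart ψ) (ψ - highPart ψ) := by
  have hint : ∀ a b : L2R3, MemFormDomain a → MemFormDomain b →
      Integrable fun x => ((γ / ‖x‖ : ℝ) : ℂ) * (conj (a x) * b x) := fun a b ha hb => by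
    refine integrable_mul_conj_mul (C := 1) ?_ (Lp.memLp a).1 (Lp.memLp b).1 (fun x => ?_)
      (integrable_coulomb hγ ha).1 (integrable_coulomb hγ hb).1
    · exact (Complex.measurable_ofReal.comp (by fun_prop)).aestronglyMeasurable
    · rw [Complex.norm_real, Real.norm_of_nonneg (by positivity), one_mul]
  have hh := memFormDomain_highPart hψ
  rw [coulombForm, coulombForm, coulombForm, ← integral_add (hint _ _ hh hh)
    (hint _ _ hh (memFormDomain_sub_highPart hψ))]
  refine integral_congr_ae ?_
  filter_upwards [Lp.coeFn_sub ψ (highPart ψ)] with x hx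
  rw [hx, Pi.sub_apply]
  ring

lemma kineticForm_highPart (ψ : L2R3) :
    kineticForm (highPart ψ) ψ =
      ((∫ ξ in highFrequency, kineticSymbol ξ * ‖(𝓕 ψ : L2R3) ξ‖ ^ 2 : ℝ) : ℂ) := by
  rw [kineticForm, ← integral_complex_ofReal, ← integral_indicator measurableSet_highFrequency]
  refine integral_congr_ae ?_
  filter_upwards [coeFn_fourier_highPart ψ] with ξ hξ
  rw [hξ]
  by_cases hm : ξ ∈ highFrequency
  · rw [Set.indicator_of_mem hm, Set.indicator_of_mem hm, mul_comm (conj _), Complex.mul_conj,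
      Complex.normSq_eq_norm_sq]
    push_cast
    rfl
  · simp [hm]

lemma inner_highPart (ψ : L2R3) :
    inner ℂ (highPart ψ) ψ =
      ((∫ ξ in highFrequency, ‖(𝓕 ψ : L2R3) ξ‖ ^ 2 : ℝ) : ℂ) := by
  rw [← Lp.inner_fourier_eq, inner_eq_integral, ← integral_complex_ofReal,
    ← integral_indicator measurableSet_highFrequency]
  refine integral_congr_ae ?_
  filter_upwards [coeFn_fourier_highPart ψ] with ξ hξ
  rw [hξ]
  by_cases hm : ξ ∈ highFrequency
  · rw [Set.indicator_of_mem hm, Set.indicator_of_mem hm, mul_comm (conj _), Complex.mul_conj,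
      Complex.normSq_eq_norm_sq]
  · simp [hm]

lemma constA_eq : constA = 2 + 2 / Real.pi * (√2 / (√2 - 1)) := by
  have hpi := Real.pi_pos
  have h1 : (1 : ℝ) < √2 := Real.lt_sqrt_of_sq_lt (by norm_num)
  have h3 : √2 - 1 ≠ 0 := by linarith
  have h2 : (2 : ℝ) ^ (3 / 2 : ℝ) = 2 * √2 := by
    rw [show (3 / 2 : ℝ) = 1 + 1 / 2 by norm_num, Real.rpow_add two_pos, Real.rpow_one,
      Real.sqrt_eq_rpow]
  rw [constA, h2]
  field_simp

/-! ### The kinetic energy bound and the conclusion -/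

/-- The bound on the kinetic energy of a bound state. -/
lemma WeakEigen.kinetic_le {γ e : ℝ} {ψ : L2R3} (hγ₀ : 0 < γ) (hγ₁ : γ < 2 / Real.pi)
    (h : WeakEigen γ e ψ) :
    e * ‖ψ‖ ^ 2 ≤ 0 ∧ (1 - γ * Real.pi / 2) * ∫ ξ, kineticSymbol ξ * ‖(𝓕 ψ : L2R3) ξ‖ ^ 2 ≤
      constA * (-e * ‖ψ‖ ^ 2) := by
  have hpi := Real.pi_pos
  have hdom := h.1
  have hvir := h.virial
  set u : L2R3 := 𝓕 ψ with hu
  have iV := integrable_virialWeight hdom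
  have iT := integrable_kineticSymbol hdom
  rw [← hu] at iV iT
  have hk : 0 ≤ √2 / (√2 - 1) := by rw [sqrt_two_div_eq]; positivity
  have hθ1 : γ * Real.pi / 2 < 1 := by
    rw [lt_div_iff₀ hpi] at hγ₁
    linarith
  have hθ0 : 0 ≤ γ * Real.pi / 2 := by positivity
  have hV0 : 0 ≤ ∫ ξ, (1 - (energySymbol ξ)⁻¹) * ‖u ξ‖ ^ 2 :=
    integral_nonneg fun ξ => mul_nonneg (virialWeight_nonneg ξ) (by positivity)
  have he : e * ‖ψ‖ ^ 2 ≤ 0 := by linarith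
  refine ⟨he, ?_⟩
  have hsplitV := integral_add_compl measurableSet_highFrequency iV
  have hsplitT := integral_add_compl measurableSet_highFrequency iT
  have hcross := norm_coulombForm_highPart_le hγ₀.le hdom
  rw [← hu, hvir] at hcross
  set Eh := ∫ ξ in highFrequency, (1 - (energySymbol ξ)⁻¹) * ‖u ξ‖ ^ 2 with hEh
  set El := ∫ ξ in highFrequencyᶜ, (1 - (energySymbol ξ)⁻¹) * ‖u ξ‖ ^ 2 with hEl
  set Th := ∫ ξ in highFrequency, kineticSymbol ξ * ‖u ξ‖ ^ 2 with hTh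
  set Tl := ∫ ξ in highFrequencyᶜ, kineticSymbol ξ * ‖u ξ‖ ^ 2 with hTl
  set N := ∫ ξ in highFrequency, ‖u ξ‖ ^ 2 with hN
  have hEh0 : 0 ≤ Eh :=
    integral_nonneg fun ξ => mul_nonneg (virialWeight_nonneg ξ) (by positivity)
  have hEl0 : 0 ≤ El :=
    integral_nonneg fun ξ => mul_nonneg (virialWeight_nonneg ξ) (by positivity)
  have hN0 : 0 ≤ N := integral_nonneg fun ξ => by positivity
  have hTlEl : Tl ≤ 2 * El := by
    rw [hTl, hEl, ← integral_const_mul]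
    refine setIntegral_mono_on iT.integrableOn (iV.const_mul 2).integrableOn
      measurableSet_highFrequency.compl fun ξ hξ => ?_
    rw [← mul_assoc]
    gcongr
    exact kineticSymbol_le_of_notMem_highFrequency hξ
  have hkato := (integrable_coulomb hγ₀.le (memFormDomain_highPart hdom)).2
  have hP : ∫ ξ, 2 * Real.pi * ‖ξ‖ * ‖(𝓕 (highPart ψ) : L2R3) ξ‖ ^ 2 ≤ Th + 2 * Eh := by
    rw [integral_mul_norm_sq_of_indicator measurableSet_highFrequency (coeFn_fourier_highPart ψ)
      (fun ξ => 2 * Real.pi * ‖ξ‖), hTh, hEh, ← integral_const_mul,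
      ← integral_add iT.integrableOn (iV.const_mul 2).integrableOn]
    refine setIntegral_mono_on ?_ (iT.add (iV.const_mul 2)).integrableOn
      measurableSet_highFrequency fun ξ hξ => ?_
    · refine (integrable_mul_norm_sq_of_le hdom (by fun_prop) fun ξ => ?_).integrableOn
      rw [abs_of_nonneg (by positivity)]
      exact two_pi_norm_le_energySymbol ξ
    · rw [← mul_assoc, ← add_mul]
      gcongr
      exact two_pi_norm_le_of_mem_highFrequency hξ
  -- Testing with the high part gives Th = V + Re X + eN, where V is its Coulomb energy and X the
  -- cross term. Dropping eN ≤ 0 leaves Th bounded by V and X.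
  have hform := h.2 _ (memFormDomain_highPart hdom)
  rw [kineticForm_highPart, coulombForm_highPart hγ₀.le hdom, coulombForm_self, inner_highPart,
    ← hu, ← hTh, ← hN] at hform
  set V := ∫ x, γ / ‖x‖ * ‖highPart ψ x‖ ^ 2 with hV
  set X := coulombForm γ (highPart ψ) (ψ - highPart ψ) with hX
  have hre : Th - (V + X.re) = e * N := by
    have := congrArg Complex.re hform
    simpa using this
  have heN : e * N ≤ 0 := by
    -- `WeakEigen` allows ψ = 0, in which case the virial identity says nothing about the sign of e
    -- but N vanishes.
    rcases eq_or_ne ψ 0 with h0 | h0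
    · have : N ≤ 0 := by
        have h1 : N ≤ ∫ ξ, ‖u ξ‖ ^ 2 := setIntegral_le_integral (integrable_norm_sq u)
          (Eventually.of_forall fun ξ => by positivity)
        rw [integral_norm_sq, hu, Lp.norm_fourier_eq, h0, norm_zero] at h1
        simpa using h1
      rw [le_antisymm this hN0, mul_zero]
    · have hn : 0 < ‖ψ‖ ^ 2 := by positivity
      have : e ≤ 0 := by
        by_contra hc
        nlinarith [mul_pos (not_le.1 hc) hn]
      exact mul_nonpos_of_nonpos_of_nonneg this hN0
  have hXre : X.re ≤ γ * (√2 / (√2 - 1)) * (-e * ‖ψ‖ ^ 2) := (Complex.re_le_norm X).trans hcross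
  have hV' : V ≤ γ * Real.pi / 2 * (Th + 2 * Eh) := hkato.trans (by gcongr)
  rw [hvir] at hsplitV
  have hγk : γ * (√2 / (√2 - 1)) * (-e * ‖ψ‖ ^ 2) ≤
      2 / Real.pi * (√2 / (√2 - 1)) * (-e * ‖ψ‖ ^ 2) := by
    have : 0 ≤ -e * ‖ψ‖ ^ 2 := by linarith
    gcongr
  rw [← hsplitT, constA_eq, add_mul]
  -- Together with the next bound, the low and high parts contribute 2(El + Eh) = 2|e|‖ψ‖², the
  -- summand 2 of `constA`; the cross term supplies the rest.
  have h1 : (1 - γ * Real.pi / 2) * Tl ≤ 2 * El := by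
    calc _ ≤ (1 - γ * Real.pi / 2) * (2 * El) :=
          mul_le_mul_of_nonneg_left hTlEl (by linarith)
      _ ≤ 1 * (2 * El) := mul_le_mul_of_nonneg_right (by linarith) (by linarith)
      _ = _ := one_mul _
  have h2 : γ * Real.pi / 2 * (2 * Eh) ≤ 1 * (2 * Eh) :=
    mul_le_mul_of_nonneg_right hθ1.le (by linarith)
  linarith

end Chandrasekhar

theorem mainTheorem5 (γ : ℝ) (hγ₀ : 0 < γ) (hγ₁ : γ < 2 / Real.pi)
    (E : ℂ) (ψ : Chandrasekhar.L2R3) (hψ : Chandrasekhar.IsEigenfunction γ E ψ)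
    (hnorm : ‖ψ‖ = 1) :
    Integrable (fun x : Chandrasekhar.R3 => γ / ‖x‖ * ‖ψ x‖ ^ 2) ∧
      ∫ x : Chandrasekhar.R3, γ / ‖x‖ * ‖ψ x‖ ^ 2 ≤
        (2 / Real.pi * Chandrasekhar.constA / (2 / Real.pi - γ) + 1) * ‖E‖ := by
  obtain ⟨e, rfl, h⟩ := hψ.exists_weakEigen
  refine ⟨(Chandrasekhar.integrable_coulomb hγ₀.le h.1).1, ?_⟩
  have hpi := Real.pi_pos
  obtain ⟨he, hT⟩ := h.kinetic_le hγ₀ hγ₁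
  have hself := h.2 ψ h.1
  rw [Chandrasekhar.kineticForm_self, Chandrasekhar.coulombForm_self,
    inner_self_eq_norm_sq_to_K, hnorm] at hself
  simp only [hnorm, one_pow, mul_one] at he hT
  -- The eigenvalue equation tested with ψ itself: kinetic energy minus Coulomb energy is e, so the
  -- kinetic bound carries over at the cost of |e|.
  have hself' : (∫ ξ, Chandrasekhar.kineticSymbol ξ * ‖(𝓕 ψ : Chandrasekhar.L2R3) ξ‖ ^ 2) -
      ∫ x, γ / ‖x‖ * ‖ψ x‖ ^ 2 = e := by
    have := congrArg Complex.re hself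
    simpa using this
  have hd : 0 < 2 / Real.pi - γ := by linarith
  have hT' : ∫ ξ, Chandrasekhar.kineticSymbol ξ * ‖(𝓕 ψ : Chandrasekhar.L2R3) ξ‖ ^ 2 ≤
      2 / Real.pi * Chandrasekhar.constA / (2 / Real.pi - γ) * -e := by
    rw [div_mul_eq_mul_div, le_div_iff₀ hd]
    calc _ = 2 / Real.pi * ((1 - γ * Real.pi / 2) *
          ∫ ξ, Chandrasekhar.kineticSymbol ξ * ‖(𝓕 ψ : Chandrasekhar.L2R3) ξ‖ ^ 2) := by
          field_simp
      _ ≤ 2 / Real.pi * (Chandrasekhar.constA * -e) := by gcongr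
      _ = _ := by ring
  rw [Complex.norm_real, Real.norm_of_nonpos he, add_mul, one_mul]
  linarith
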